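/- Let $n,p_x,p_y\ge 1$. For $i=1,\dots,n$ let $g_i:\mathbb R^{p_x}\to\mathbb R$, $h_i:\mathbb R^{p_y}\to\mathbb R$ be differentiable and $P_i\in\mathbb R^{p_y\times p_x}$. Put $G=\frac1n\sum_i g_i$, $H=\frac1n\sum_i h_i$, $\overline P=\frac1n\sum_i P_i$, and consider $$\min_{\mathbf x\in\mathbb R^{p_x}}\max_{\mathbf y\in\mathbb R^{p_y}}F(\mathbf x,\mathbf y),\qquad F(\mathbf x,\mathbf y)=G(\mathbf x)+\langle \mathbf y,\overline P\mathbf x\rangle-H(\mathbf y).$$ Assume that every $\nabla g_i$ is $L_1$-Lipschitz and every $\nabla h_i$ is $L_2$-Lipschitz ($L_1,L_2>0$), that $G$ is convex and $H$ is $\mu$-strongly convex ($\mu>0$), and that $\overline P$ has full column rank, with largest and smallest singular values $\sigma_M$ and $\sigma_m$. Let $W=(w_{ir})\in\mathbb R^{n\times n}$ be primitive and doubly stochastic with $\lambda:=\|W-\frac1n\mathbf 1_n\mathbf 1_n^\top\|<1$ (spectral norm). Put $L=\max\{L_1,L_2\}$, $\kappa=L/\mu$, $\gamma=\sigma_M/\sigma_m$.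 The method GT-GDA with stepsizes $\alpha,\beta$ starts from arbitrary $\mathbf x_i^0,\mathbf y_i^0$ and $P_i^0=P_i$. With $f_i^k(\mathbf x,\mathbf y)=g_i(\mathbf x)+\langle\mathbf y,P_i^k\mathbf x\rangle-h_i(\mathbf y)$ and $\nabla_x\mathbf f_i^k=\nabla_xf_i^k(\mathbf x_i^k,\mathbf y_i^k)$, $\nabla_y\mathbf f_i^k=\nabla_yf_i^k(\mathbf x_i^k,\mathbf y_i^k)$, it sets $\mathbf q_i^0=\nabla_x\mathbf f_i^0$, $\mathbf w_i^0=\nabla_y\mathbf f_i^0$ and iterates $$P_i^{k+1}=\sum_r w_{ir}P_r^k,\quad \mathbf x_i^{k+1}=\sum_r w_{ir}(\mathbf x_r^k-\alpha\mathbf q_r^k),\quad \mathbf y_i^{k+1}=\sum_r w_{ir}(\mathbf y_r^k+\beta\mathbf w_r^k),$$ $$\mathbf q_i^{k+1}=\sum_r w_{ir}(\mathbf q_r^k+\nabla_x\mathbf f_r^{k+1}-\nabla_x\mathbf f_r^k),\quad \mathbf w_i^{k+1}=\sum_r w_{ir}(\mathbf w_r^k+\nabla_y\mathbf f_r^{k+1}-\nabla_y\mathbf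 f_r^k).$$ There is an absolute constant $C>0$, and for all $L_1,L_2,\mu,\sigma_m,\sigma_M>0$ there is a $c_0>0$ depending only on these five numbers (in particular not on $n$, $W$ or $\lambda$), such that for every $c\ge c_0$ the following holds for all data as above. Let $$\beta=\overline\beta:=\min\Big\{\frac{\sigma_m^2(1-\lambda)^2}{192\,\sigma_M^2L},\ \frac{L(1-\lambda)^2}{48\,\sigma_M^2},\ \frac1{382\,\kappa L}\Big\},\qquad \alpha=\overline\alpha:=\overline\beta\,\frac{\mu^2}{c\,\sigma_M^2},$$ and suppose $$\gamma^2\kappa^4\ \ge\ \max\Big\{\frac{\gamma^6\kappa^2}{(1-\lambda)^4},\ \frac{\sigma_m^2\sigma_M^2}{L^2\mu^2(1-\lambda)^4}\Big\}.$$ Then $F$ has a unique saddle point $(\mathbf x^*,\mathbf y^*)$, and from every starting point GT-GDA converges to it linearly at a network-independent rate: with $$e_k:=\Big(\sum_i\|\mathbf x_i^k-\mathbf x^*\|^2\Big)^{1/2}+\Big(\sum_i\|\mathbf y_i^k-\mathbf y^*\|^2\Big)^{1/2}$$ there is a $\psi>0$ (depending on the data and the starting point) with $e_k\le\psi\big(1-\frac1{C\,c\,\gamma^2\kappa^5}\big)^k$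 for all $k\ge0$, and, for all sufficiently small $\epsilon>0$, $e_k\le\epsilon$ for every $k\ge C\,c\,\gamma^2\kappa^5\log\frac1\epsilon$; that is, an $\epsilon$-optimal solution is reached in $\mathcal O(\gamma^2\kappa^5\log\frac1\epsilon)$ iterations, each with one gradient computation per node. -/

import Mathlib

open scoped BigOperators

noncomputable section

namespace GTGDA

/-- `ℝ^p` with the Euclidean norm and inner product. -/
abbrev Vec (p : ℕ) : Type := EuclideanSpace ℝ (Fin p)

/-- The average `(1/n) ∑ᵢ vᵢ` of the quantities held by the `n` nodes. -/
def average {n : ℕ} {E : Type*} [AddCommGroup E] [Module ℝ E] (v : Fin n → E) : E :=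
  (1 / (n : ℝ)) • ∑ i, v i

/-! ### The saddle point problem -/

/-- The cost `g(x) + ⟨y, P x⟩ - h(y)`. -/
def cost {px py : ℕ} (g : Vec px → ℝ) (h : Vec py → ℝ) (P : Matrix (Fin py) (Fin px) ℝ)
    (x : Vec px) (y : Vec py) : ℝ :=
  g x + inner ℝ y (Matrix.toEuclideanLin P x) - h y

/-- The private data of the `n` nodes: node `i` holds the local cost
`fᵢ(x, y) = gᵢ(x) + ⟨y, Pᵢ x⟩ - hᵢ(y)`. -/
structure Problem (n px py : ℕ) where
  g : Fin n → Vec px → ℝ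
  h : Fin n → Vec py → ℝ
  P : Fin n → Matrix (Fin py) (Fin px) ℝ

namespace Problem

variable {n px py : ℕ} (prob : Problem n px py)

/-- The global function `G = (1/n) ∑ᵢ gᵢ`. -/
def G : Vec px → ℝ := average prob.g

/-- The global function `H = (1/n) ∑ᵢ hᵢ`. -/
def H : Vec py → ℝ := average prob.h

/-- The global coupling matrix `P̄ = (1/n) ∑ᵢ Pᵢ`. -/
def Pbar : Matrix (Fin py) (Fin px) ℝ := average prob.P

/-- The global objective `F(x, y) = (1/n) ∑ᵢ fᵢ(x, y)`. -/
def F (x : Vec px) (y : Vec py) : ℝ :=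
  average fun i => cost (prob.g i) (prob.h i) (prob.P i) x y

/-- `(x, y)` is a saddle point of `F`: `F(x, y') ≤ F(x', y)` for all `x'`, `y'`, that is,
`F(x, y') ≤ F(x, y) ≤ F(x', y)` for all `x'`, `y'`. -/
def IsSaddle (x : Vec px) (y : Vec py) : Prop :=
  IsSaddlePointOn Set.univ Set.univ prob.F x y

end Problem

/-- `f` is differentiable and `∇ f` is `L`-Lipschitz. -/
def IsSmooth {p : ℕ} (L : ℝ) (f : Vec p → ℝ) : Prop :=
  Differentiable ℝ f ∧ ∀ x y, ‖gradient f x - gradient f y‖ ≤ L * ‖x - y‖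

/-- `f` is differentiable and `f(y) + ⟨∇ f(y), x - y⟩ + (μ/2) ‖x - y‖² ≤ f(x)` for all `x`, `y`. -/
def IsStronglyConvex {p : ℕ} (μ : ℝ) (f : Vec p → ℝ) : Prop :=
  Differentiable ℝ f ∧
    ∀ x y, f y + inner ℝ (gradient f y) (x - y) + μ / 2 * ‖x - y‖ ^ 2 ≤ f x

/-- Smoothness and convexity: each `gᵢ` is `L₁`-smooth, each `hᵢ` is `L₂`-smooth, the average `G`
is convex and the average `H` is `μ`-strongly convex (the local functions may be nonconvex). -/
structure SmoothConvex {n px py : ℕ} (prob : Problem n px py) (L₁ L₂ μ : ℝ) : Prop where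
  smooth_g : ∀ i, IsSmooth L₁ (prob.g i)
  smooth_h : ∀ i, IsSmooth L₂ (prob.h i)
  convex_G : ConvexOn ℝ Set.univ prob.G
  stronglyConvex_H : IsStronglyConvex μ prob.H

/-- The largest singular value of a matrix with `px ≥ 1` columns (Mathlib lists the singular
values in descending order, starting at the index `0`). -/
def sigmaMax {px py : ℕ} (P : Matrix (Fin py) (Fin px) ℝ) : ℝ :=
  (Matrix.toEuclideanLin P).singularValues 0

/-- The smallest of the `px` singular values of a matrix with `px ≥ 1` columns. -/
def sigmaMin {px py : ℕ} (P : Matrix (Fin py) (Fin px) ℝ) : ℝ :=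
  (Matrix.toEuclideanLin P).singularValues (px - 1)

/-! ### The network -/

/-- `λ = ‖W - (1/n) 1 1ᵀ‖`, in the spectral norm. -/
def lam {n : ℕ} (W : Matrix (Fin n) (Fin n) ℝ) : ℝ :=
  ‖Matrix.toEuclideanCLM (n := Fin n) (𝕜 := ℝ) (W - Matrix.of fun _ _ => 1 / (n : ℝ))‖

/-- The vector held by node `i` after one round of averaging with the weights `W`:
`∑ᵣ w_{ir} vᵣ`. -/
def mix {n : ℕ} {E : Type*} [AddCommGroup E] [Module ℝ E] (W : Matrix (Fin n) (Fin n) ℝ)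
    (v : Fin n → E) (i : Fin n) : E :=
  ∑ r, W i r • v r

/-! ### The algorithm -/

/-- The variables of all nodes at one time: `Pᵢᵏ`, `xᵢᵏ`, `qᵢᵏ`, `yᵢᵏ`, `wᵢᵏ`. -/
structure State (n px py : ℕ) where
  P : Fin n → Matrix (Fin py) (Fin px) ℝ
  x : Fin n → Vec px
  q : Fin n → Vec px
  y : Fin n → Vec py
  w : Fin n → Vec py

/-- The partial gradient in `x` of `gᵢ(x) + ⟨y, P x⟩ - hᵢ(y)`, where `P` is node `i`'s current
coupling matrix. -/
def gradX {n px py : ℕ} (prob : Problem n px py) (P : Fin n → Matrix (Fin py) (Fin px) ℝ)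
    (x : Fin n → Vec px) (y : Fin n → Vec py) (i : Fin n) : Vec px :=
  gradient (fun x' => cost (prob.g i) (prob.h i) (P i) x' (y i)) (x i)

/-- The partial gradient in `y` of `gᵢ(x) + ⟨y, P x⟩ - hᵢ(y)`, where `P` is node `i`'s current
coupling matrix. -/
def gradY {n px py : ℕ} (prob : Problem n px py) (P : Fin n → Matrix (Fin py) (Fin px) ℝ)
    (x : Fin n → Vec px) (y : Fin n → Vec py) (i : Fin n) : Vec py :=
  gradient (fun y' => cost (prob.g i) (prob.h i) (P i) (x i) y') (y i)

/-- Initialization: `Pᵢ⁰ = Pᵢ`, arbitrary `xᵢ⁰`, `yᵢ⁰`, and the trackers start at the local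
gradients. -/
def init {n px py : ℕ} (prob : Problem n px py) (x₀ : Fin n → Vec px) (y₀ : Fin n → Vec py) :
    State n px py where
  P := prob.P
  x := x₀
  q := gradX prob prob.P x₀ y₀
  y := y₀
  w := gradY prob prob.P x₀ y₀

/-- One iteration of GT-GDA with the stepsizes `α` (descent in `x`) and `β` (ascent in `y`). -/
def step {n px py : ℕ} (prob : Problem n px py) (W : Matrix (Fin n) (Fin n) ℝ) (α β : ℝ)
    (s : State n px py) : State n px py :=
  let P' := mix W s.P
  let x' := mix W fun r => s.x r - α • s.q r
  let y' := mix W fun r => s.y r + β • s.w r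
  { P := P'
    x := x'
    q := mix W fun r => s.q r + gradX prob P' x' y' r - gradX prob s.P s.x s.y r
    y := y'
    w := mix W fun r => s.w r + gradY prob P' x' y' r - gradY prob s.P s.x s.y r }

/-- The state of GT-GDA after `k` iterations. The iterates `xᵢᵏ`, `yᵢᵏ` are computed from the
gradients at the times `0, …, k - 1`: one evaluation of the local gradient per node and
iteration. -/
def iterate {n px py : ℕ} (prob : Problem n px py) (W : Matrix (Fin n) (Fin n) ℝ) (α β : ℝ)
    (x₀ : Fin n → Vec px) (y₀ : Fin n → Vec py) (k : ℕ) : State n px py :=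
  (step prob W α β)^[k] (init prob x₀ y₀)

/-- The norm `‖v - 1ₙ ⊗ z‖` of the stacked vector in `ℝ^{np}`. -/
def stackedDist {n p : ℕ} (v : Fin n → Vec p) (z : Vec p) : ℝ :=
  Real.sqrt (∑ i, ‖v i - z‖ ^ 2)

/-- The error `‖x - 1ₙ ⊗ x*‖ + ‖y - 1ₙ ⊗ y*‖` of a state; a state is an `ε`-optimal solution if
this is at most `ε`. -/
def State.error {n px py : ℕ} (s : State n px py) (xs : Vec px) (ys : Vec py) : ℝ :=
  stackedDist s.x xs + stackedDist s.y ys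

/-- The stepsize `β̄`, with `l` in the role of `λ`. -/
def betaBar (L μ σm σM l : ℝ) : ℝ :=
  min (σm ^ 2 * (1 - l) ^ 2 / (192 * σM ^ 2 * L))
    (min (L * (1 - l) ^ 2 / (48 * σM ^ 2)) (1 / (382 * (L / μ) * L)))

/-- The stepsize `ᾱ = β̄ μ² / (c σ_M²)`. -/
def alphaBar (c L μ σm σM l : ℝ) : ℝ :=
  betaBar L μ σm σM l * (μ ^ 2 / (c * σM ^ 2))

end GTGDA

end

/-!
Eliminating `y` turns the saddle point problem into the minimization of the primal function
`Φ(x) = G(x) + max_y (⟨y, P̄ x⟩ - H(y))`, whose gradient is `∇G(x) + P̄ᵀ Y(x)` with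
`∇H(Y(x)) = P̄ x`. Although `G` is merely convex, this gradient is strongly monotone with constant
`μ σ_m² / L²`, because `P̄` has trivial kernel and `∇H` is strongly monotone and Lipschitz
(`SaddleOperators.monotone_primal`). Hence there is exactly one stationary point, which by
convexity-concavity is the saddle point, and short gradient steps on `Φ` are contractions
(`norm_step_sub_step_le`).

GT-GDA is an inexact version of such steps. Its state is measured by six numbers: the distance
of the average `x̄` from `x*`, that of `ȳ` from `Y(x̄)`, and the consensus errors of `x`, `q`, `y`, `w`.
Since `W` contracts deviations from the average by `λ` and the trackers average to the average
gradients, these numbers satisfy a linear recursion, perturbed by the disagreement about the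
coupling matrices (`Setting.recursion`); the latter decays like `λᵏ` times the size of the state.

The recursion has two time scales. At `α = 0` all errors but the first contract in a suitable
weighted sum: `x` is autonomous, `y`, `w` and the dual error form a loop whose gain is small
because `β L` is at most `(1 - λ)² / 192` and at most `1 / (382 κ)`, and `q` is driven by the others
without feeding back. For small `α` a further weighted sum contracts at the rate of the first
error, `1 - α μ σ_m² / (2 L²)` (`Errors.exists_energy_le`).
The assumption on `γ² κ⁴` bounds `1 - λ` and `β̄` below in terms of `L` and `μ`
(`betaBar_bounds`), so how small `α` must be depends on the problem constants only, and a large `c`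
ensures it. With `β̄ ≥ μ² / (382 L³)` the rate becomes at most `1 - 1 / (764 c γ² κ⁵)`
(`rate_bound`). The claimed rate is slightly slower, which leaves room to absorb the geometrically
decaying perturbation (`geometric_of_perturbed`).
-/

noncomputable section

namespace GTGDA

/-! ### Stacked vectors, averages and deviations -/

section Average

variable {n : ℕ} {E F : Type*} [AddCommGroup E] [Module ℝ E] [AddCommGroup F] [Module ℝ F]

lemma average_add (u v : Fin n → E) :
    average (fun i => u i + v i) = average u + average v := by
  simp [average, Finset.sum_add_distrib]

lemma average_sub (u v : Fin n → E) :
    average (fun i => u i - v i) = average u - average v := by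
  simp [average, Finset.sum_sub_distrib, smul_sub]

lemma average_smul (a : ℝ) (v : Fin n → E) :
    average (fun i => a • v i) = a • average v := by
  simp [average, ← Finset.smul_sum, smul_comm a]

lemma map_average (f : E →ₗ[ℝ] F) (v : Fin n → E) :
    f (average v) = average fun i => f (v i) := by
  simp [average]

lemma average_const (hn : n ≠ 0) (z : E) : average (fun _ : Fin n => z) = z := by
  have : (n : ℝ) ≠ 0 := by exact_mod_cast hn
  simp [average, ← Nat.cast_smul_eq_nsmul ℝ, smul_smul, this]

/-- The deviation of each node's vector from the average over the nodes. -/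
def dev (v : Fin n → E) (i : Fin n) : E := v i - average v

lemma average_dev (v : Fin n → E) : average (dev v) = 0 := by
  rcases Nat.eq_zero_or_pos n with rfl | hn
  · simp [average]
  · unfold dev
    rw [average_sub, average_const hn.ne', sub_self]

variable {W : Matrix (Fin n) (Fin n) ℝ}

lemma average_mix (hW : W ∈ doublyStochastic ℝ (Fin n)) (v : Fin n → E) :
    average (mix W v) = average v := by
  unfold average mix
  rw [Finset.sum_comm]
  simp_rw [← Finset.sum_smul, sum_col_of_mem_doublyStochastic hW, one_smul]

lemma map_mix (f : E →ₗ[ℝ] F) (v : Fin n → E) (i : Fin n) :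
    f (mix W v i) = mix W (fun r => f (v r)) i := by
  simp [mix]

/-- On deviations, one round of averaging acts as the matrix `W - (1/n) 1 1ᵀ`. -/
lemma dev_mix (hW : W ∈ doublyStochastic ℝ (Fin n)) (v : Fin n → E) :
    dev (mix W v) = mix (W - Matrix.of fun _ _ => 1 / (n : ℝ)) (dev v) := by
  funext i
  have h0 : (∑ r, (1 / (n : ℝ)) • dev v r) = 0 := by
    rw [← Finset.smul_sum]; exact average_dev v
  have h1 : ∑ r, W i r • average v = average v := by
    rw [← Finset.sum_smul, sum_row_of_mem_doublyStochastic hW, one_smul]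
  calc dev (mix W v) i = (∑ r, W i r • v r) - average v := by
        rw [dev, average_mix hW]; rfl
    _ = ∑ r, W i r • dev v r := by
        simp only [dev, smul_sub, Finset.sum_sub_distrib, h1]
    _ = (∑ r, W i r • dev v r) - ∑ r, (1 / (n : ℝ)) • dev v r := by rw [h0, sub_zero]
    _ = _ := by
        simp only [mix, Matrix.sub_apply, Matrix.of_apply, sub_smul, Finset.sum_sub_distrib]

end Average

section StackNorm

variable {n : ℕ} {E F : Type*} [NormedAddCommGroup E] [NormedAddCommGroup F]

/-- The Euclidean norm of the stacked vector `(v₁, …, vₙ)`. -/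
def stackNorm (v : Fin n → E) : ℝ := √(∑ i, ‖v i‖ ^ 2)

lemma stackNorm_eq_norm (v : Fin n → E) :
    stackNorm v = ‖(WithLp.toLp 2 v : PiLp 2 fun _ : Fin n => E)‖ := by
  rw [PiLp.norm_eq_of_L2]; rfl

lemma stackNorm_nonneg (v : Fin n → E) : 0 ≤ stackNorm v := Real.sqrt_nonneg _

lemma sq_stackNorm (v : Fin n → E) : stackNorm v ^ 2 = ∑ i, ‖v i‖ ^ 2 :=
  Real.sq_sqrt (by positivity)

lemma stackNorm_add_le (u v : Fin n → E) :
    stackNorm (fun i => u i + v i) ≤ stackNorm u + stackNorm v := by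
  simp only [stackNorm_eq_norm]
  exact norm_add_le (WithLp.toLp 2 u : PiLp 2 fun _ : Fin n => E) (WithLp.toLp 2 v)

lemma stackNorm_sub_le (u v : Fin n → E) :
    stackNorm (fun i => u i - v i) ≤ stackNorm u + stackNorm v := by
  simp only [stackNorm_eq_norm]
  exact norm_sub_le (WithLp.toLp 2 u : PiLp 2 fun _ : Fin n => E) (WithLp.toLp 2 v)

lemma stackNorm_le_of_norm_le {u : Fin n → E} {v : Fin n → F} {a : ℝ} (ha : 0 ≤ a)
    (h : ∀ i, ‖u i‖ ≤ a * ‖v i‖) : stackNorm u ≤ a * stackNorm v := by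
  refine Real.sqrt_le_iff.2 ⟨mul_nonneg ha (stackNorm_nonneg v), ?_⟩
  rw [mul_pow, sq_stackNorm, Finset.mul_sum]
  refine Finset.sum_le_sum fun i _ => ?_
  rw [← mul_pow]
  exact pow_le_pow_left₀ (norm_nonneg _) (h i) 2

lemma norm_le_stackNorm (v : Fin n → E) (i : Fin n) : ‖v i‖ ≤ stackNorm v := by
  refine Real.le_sqrt_of_sq_le ?_
  exact Finset.single_le_sum (f := fun i => ‖v i‖ ^ 2) (fun j _ => by positivity)
    (Finset.mem_univ i)

lemma stackNorm_const (z : E) : stackNorm (fun _ : Fin n => z) = √n * ‖z‖ := by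
  simp [stackNorm]

lemma stackNorm_smul [NormedSpace ℝ E] {a : ℝ} (ha : 0 ≤ a) (v : Fin n → E) :
    stackNorm (fun i => a • v i) = a * stackNorm v := by
  simp [stackNorm, norm_smul, mul_pow, ← Finset.mul_sum, Real.sqrt_mul, ha]

lemma sqrt_mul_norm_average_le [NormedSpace ℝ E] (v : Fin n → E) :
    √n * ‖average v‖ ≤ stackNorm v := by
  rcases Nat.eq_zero_or_pos n with rfl | hn
  · simpa using stackNorm_nonneg v
  have hn' : (0 : ℝ) < n := by exact_mod_cast hn
  refine Real.le_sqrt_of_sq_le ?_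
  have h1 : ‖average v‖ ≤ (1 / (n : ℝ)) * ∑ i, ‖v i‖ := by
    rw [average, norm_smul, Real.norm_of_nonneg (by positivity)]
    gcongr
    exact norm_sum_le _ _
  have h2 : (∑ i, ‖v i‖) ^ 2 ≤ n * ∑ i, ‖v i‖ ^ 2 := by
    simpa using sq_sum_le_card_mul_sum_sq (s := Finset.univ) (f := fun i => ‖v i‖)
  calc (√n * ‖average v‖) ^ 2 = n * ‖average v‖ ^ 2 := by
        rw [mul_pow, Real.sq_sqrt hn'.le]
    _ ≤ n * ((1 / (n : ℝ)) * ∑ i, ‖v i‖) ^ 2 := by gcongr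
    _ = (1 / (n : ℝ)) * (∑ i, ‖v i‖) ^ 2 := by field_simp
    _ ≤ (1 / (n : ℝ)) * (n * ∑ i, ‖v i‖ ^ 2) := by gcongr
    _ = _ := by field_simp

lemma stackNorm_le_dev_add [NormedSpace ℝ E] (v : Fin n → E) :
    stackNorm v ≤ stackNorm (dev v) + √n * ‖average v‖ := by
  rw [← stackNorm_const]
  simpa [dev] using stackNorm_add_le (dev v) (fun _ => average v)

end StackNorm

section InnerProduct

variable {n : ℕ} {E : Type*} [NormedAddCommGroup E] [InnerProductSpace ℝ E]

/-- Subtracting the average is an orthogonal projection of the stacked space. -/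
lemma stackNorm_dev_le (v : Fin n → E) : stackNorm (dev v) ≤ stackNorm v := by
  rcases Nat.eq_zero_or_pos n with rfl | hn
  · simp [stackNorm]
  have hn' : (n : ℝ) ≠ 0 := by positivity
  refine Real.sqrt_le_sqrt ?_
  have hsum : ∑ i, v i = (n : ℝ) • average v := by
    simp [average, smul_smul, hn']
  have : ∑ i, ‖dev v i‖ ^ 2 = ∑ i, ‖v i‖ ^ 2 - n * ‖average v‖ ^ 2 := by
    simp only [dev, norm_sub_sq_real, Finset.sum_add_distrib, Finset.sum_sub_distrib,
      ← Finset.mul_sum, ← sum_inner, hsum, real_inner_smul_left, real_inner_self_eq_norm_sq]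
    simp
    ring
  rw [this]
  have : 0 ≤ (n : ℝ) * ‖average v‖ ^ 2 := by positivity
  linarith

lemma stackNorm_mix_le [FiniteDimensional ℝ E] (M : Matrix (Fin n) (Fin n) ℝ) (v : Fin n → E) :
    stackNorm (mix M v) ≤ ‖Matrix.toEuclideanCLM (n := Fin n) (𝕜 := ℝ) M‖ * stackNorm v := by
  set c := ‖Matrix.toEuclideanCLM (n := Fin n) (𝕜 := ℝ) M‖
  have hc : 0 ≤ c := norm_nonneg _
  refine Real.sqrt_le_iff.2 ⟨mul_nonneg hc (stackNorm_nonneg v), ?_⟩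
  rw [mul_pow, sq_stackNorm]
  let b := stdOrthonormalBasis ℝ E
  have hnorm : ∀ z : E, ‖z‖ ^ 2 = ∑ j, (b.repr z j) ^ 2 := fun z => by
    rw [← b.repr.norm_map z, EuclideanSpace.real_norm_sq_eq]
  simp_rw [hnorm]
  rw [Finset.sum_comm, Finset.sum_comm (γ := Fin n), Finset.mul_sum]
  refine Finset.sum_le_sum fun j _ => ?_
  let u : EuclideanSpace ℝ (Fin n) := WithLp.toLp 2 fun i => b.repr (v i) j
  have h := (Matrix.toEuclideanCLM (n := Fin n) (𝕜 := ℝ) M).le_opNorm u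
  have h2 := pow_le_pow_left₀ (norm_nonneg _) h 2
  rw [mul_pow, EuclideanSpace.real_norm_sq_eq, EuclideanSpace.real_norm_sq_eq] at h2
  convert h2 using 3 with i _
  rw [Matrix.ofLp_toEuclideanCLM]
  simp [mix, u, Matrix.mulVec, dotProduct]

variable {W : Matrix (Fin n) (Fin n) ℝ}

lemma lam_nonneg (W : Matrix (Fin n) (Fin n) ℝ) : 0 ≤ lam W := norm_nonneg _

lemma stackNorm_dev_mix_le [FiniteDimensional ℝ E] (hW : W ∈ doublyStochastic ℝ (Fin n))
    (v : Fin n → E) : stackNorm (dev (mix W v)) ≤ lam W * stackNorm (dev v) := by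
  rw [dev_mix hW]
  exact stackNorm_mix_le _ _

end InnerProduct

/-! ### The scalar error recursion and its Lyapunov function -/

/-- The six error quantities of a state of GT-GDA, in stacked norms: `opt` is the distance of the
averaged `x` from the saddle point, `dual` that of the averaged `y` from the maximizer for the
averaged `x`, and `x`, `q`, `y`, `w` are the consensus errors of the four vectors. -/
structure Errors where
  opt : ℝ
  dual : ℝ
  x : ℝ
  q : ℝ
  y : ℝ
  w : ℝ

namespace Errors

/-- All six quantities are nonnegative. -/
structure Nonneg (e : Errors) : Prop where
  opt : 0 ≤ e.opt
  dual : 0 ≤ e.dual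
  x : 0 ≤ e.x
  q : 0 ≤ e.q
  y : 0 ≤ e.y
  w : 0 ≤ e.w

/-- A bound for the (stacked) average of the gradients in `x`; `K` is a Lipschitz constant of the
gradient of the primal function and `δ` measures the disagreement about the coupling matrix. -/
def drift (L σ K δ : ℝ) (e : Errors) : ℝ := K * e.opt + L * e.x + σ * e.dual + δ

/-- A bound for the movement of the stacked `x` in one iteration. -/
def moveX (L σ K α δ : ℝ) (e : Errors) : ℝ := 2 * e.x + α * e.q + α * e.drift L σ K δ

/-- A bound for the movement of the stacked `y` in one iteration. -/
def moveY (L β δ : ℝ) (e : Errors) : ℝ := 2 * e.y + β * e.w + β * (L * (e.dual + e.y) + δ)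

/-- The coupled inequalities between the errors of consecutive states. -/
structure Recursion (L μ σ m K α β l δ : ℝ) (e e' : Errors) : Prop where
  opt : e'.opt ≤ (1 - 3 / 4 * (α * m)) * e.opt + α * (L * e.x + σ * e.dual + δ)
  dual : e'.dual ≤ (1 - 3 / 4 * (β * μ)) * e.dual + β * (L * e.y + δ)
    + σ / μ * (α * e.drift L σ K δ)
  x : e'.x ≤ l * (e.x + α * e.q)
  y : e'.y ≤ l * (e.y + β * e.w)
  q : e'.q ≤ l * (e.q + L * e.moveX L σ K α δ + σ * e.moveY L β δ + δ)
  w : e'.w ≤ l * (e.w + σ * e.moveX L σ K α δ + L * e.moveY L β δ + δ)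

/-- The weighted sum of the errors which, for `α = 0`, contract at a rate independent of `α`. -/
def fast (a b z ζ : ℝ) (e : Errors) : ℝ := e.dual + a * e.y + b * e.w + z * e.x + ζ * e.q

/-- The Lyapunov function: the slow error `opt` plus a multiple of the fast ones. -/
def energy (A a b z ζ : ℝ) (e : Errors) : ℝ := e.opt + A * e.fast a b z ζ

/-- If the weights dominate the columns of the matrix of the recursion at `α = 0`, then the fast
errors contract up to terms of order `α` and `δ`. -/
lemma fast_le {L μ σ m K α β l δ a b z ζ η : ℝ} {e e' : Errors}
    (hL : 0 < L) (hσ : 0 < σ) (hK : 0 < K) (hα : 0 ≤ α) (hβ : 0 ≤ β) (hl : l ≤ 1)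
    (hδ : 0 ≤ δ) (ha : 0 < a) (hb : 0 < b) (hz : 0 < z) (hζ : 0 < ζ)
    (h_dual : (1 - 3 / 4 * (β * μ)) + (b * L + ζ * σ) * (β * L) ≤ 1 - η)
    (h_y : β * L + a * l + (b * L + ζ * σ) * (2 + β * L) ≤ a * (1 - η))
    (h_w : a * β + b * l + (b * L + ζ * σ) * β ≤ b * (1 - η))
    (h_x : z * l + 2 * (b * σ + ζ * L) ≤ z * (1 - η))
    (h_q : ζ * l ≤ ζ * (1 - η))
    (he : e.Nonneg) (h : Recursion L μ σ m K α β l δ e e') :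
    e'.fast a b z ζ ≤ (1 - η) * e.fast a b z ζ
      + α * ((σ / μ + b * σ + ζ * L) * e.drift L σ K δ + (z + b * σ + ζ * L) * e.q)
      + (β + b + ζ + (b * L + ζ * σ) * β) * δ := by
  obtain ⟨ho, hd, hx, hq, hy, hw⟩ := he
  have hD : 0 ≤ e.drift L σ K δ := by unfold drift; positivity
  have hX : 0 ≤ e.moveX L σ K α δ := by unfold moveX; positivity
  have hY : 0 ≤ e.moveY L β δ := by unfold moveY; positivity
  have hx' : e'.x ≤ l * e.x + α * e.q := by
    have h1 := mul_le_mul_of_nonneg_right hl (mul_nonneg hα hq)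
    linarith [h.x]
  have hy' : e'.y ≤ l * e.y + β * e.w := by
    have h1 := mul_le_mul_of_nonneg_right hl (mul_nonneg hβ hw)
    linarith [h.y]
  have hq' : e'.q ≤ l * e.q + (L * e.moveX L σ K α δ + σ * e.moveY L β δ + δ) := by
    have h1 : l * (L * e.moveX L σ K α δ + σ * e.moveY L β δ + δ)
        ≤ 1 * (L * e.moveX L σ K α δ + σ * e.moveY L β δ + δ) :=
      mul_le_mul_of_nonneg_right hl (by positivity)
    linarith [h.q]
  have hw' : e'.w ≤ l * e.w + (σ * e.moveX L σ K α δ + L * e.moveY L β δ + δ) := by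
    have h1 : l * (σ * e.moveX L σ K α δ + L * e.moveY L β δ + δ)
        ≤ 1 * (σ * e.moveX L σ K α δ + L * e.moveY L β δ + δ) :=
      mul_le_mul_of_nonneg_right hl (by positivity)
    linarith [h.w]
  have e1 := h.dual
  have e2 := mul_le_mul_of_nonneg_left hy' ha.le
  have e3 := mul_le_mul_of_nonneg_left hw' hb.le
  have e4 := mul_le_mul_of_nonneg_left hx' hz.le
  have e5 := mul_le_mul_of_nonneg_left hq' hζ.le
  have c1 := mul_le_mul_of_nonneg_right h_dual hd
  have c2 := mul_le_mul_of_nonneg_right h_y hy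
  have c3 := mul_le_mul_of_nonneg_right h_w hw
  have c4 := mul_le_mul_of_nonneg_right h_x hx
  have c5 := mul_le_mul_of_nonneg_right h_q hq
  unfold moveX at e3 e5
  unfold moveY at e3 e5
  unfold fast
  generalize e.drift L σ K δ = D at *
  linarith

/-- Two coupled quantities on separate time scales: a slow one contracting at a rate of order `α`
and a fast one contracting at a fixed rate, with couplings of order `α`. For small `α` their
weighted sum contracts at the rate of the slow one. -/
lemma two_time_scale {m η K₁ K₂ A α X U X' U' r s : ℝ} (hA : 0 < A) (hα : 0 ≤ α)
    (hX : 0 ≤ X) (hU : 0 ≤ U) (hAK : A * K₁ ≤ m / 4)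
    (hαη : α * (A * K₁ + K₂ + A * (m / 2)) ≤ A * η)
    (h₁ : X' ≤ (1 - 3 / 4 * (α * m)) * X + α * K₂ * U + r)
    (h₂ : U' ≤ (1 - η) * U + α * K₁ * (X + U) + s) :
    X' + A * U' ≤ (1 - α * m / 2) * (X + A * U) + (r + A * s) := by
  have h3 := mul_le_mul_of_nonneg_left h₂ hA.le
  have h4 := mul_le_mul_of_nonneg_right (mul_le_mul_of_nonneg_left hAK hα) hX
  have h5 := mul_le_mul_of_nonneg_right hαη hU
  linarith

/-- Weights as `fast_le` asks for, and the resulting rate `η`. Only the weight of `e.y` has to be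
adapted to `β` and `l`. -/
lemma exists_weights {L μ σ : ℝ} (hμ : 0 < μ) (hμL : μ ≤ L) (hσ : 0 < σ) :
    ∃ b z ζ η : ℝ, 0 < b ∧ 0 < z ∧ 0 < ζ ∧ 0 < η ∧ ∀ β l : ℝ, 0 ≤ l → l ≤ 1 - μ / L →
      μ ^ 2 / (382 * L ^ 3) ≤ β → β * L ≤ (1 - l) ^ 2 / 192 → β * L ≤ μ / (382 * L) →
      ∃ a : ℝ, 0 < a ∧
        (1 - 3 / 4 * (β * μ)) + (b * L + ζ * σ) * (β * L) ≤ 1 - η ∧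
        β * L + a * l + (b * L + ζ * σ) * (2 + β * L) ≤ a * (1 - η) ∧
        a * β + b * l + (b * L + ζ * σ) * β ≤ b * (1 - η) ∧
        z * l + 2 * (b * σ + ζ * L) ≤ z * (1 - η) ∧
        ζ * l ≤ ζ * (1 - η) := by
  have hL : 0 < L := hμ.trans_le hμL
  obtain ⟨b, hb⟩ : ∃ b, b = μ / (4 * L ^ 2) := ⟨_, rfl⟩
  obtain ⟨ζ, hζ⟩ : ∃ ζ, ζ = μ / (16 * L * σ) := ⟨_, rfl⟩
  obtain ⟨z, hz⟩ : ∃ z, z = 4 * (b * σ + ζ * L) * (L / μ) := ⟨_, rfl⟩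
  obtain ⟨η, hη⟩ : ∃ η, η = (μ / L) ^ 3 / 1000 := ⟨_, rfl⟩
  have hb0 : 0 < b := by rw [hb]; positivity
  have hζ0 : 0 < ζ := by rw [hζ]; positivity
  have hz0 : 0 < z := by rw [hz]; positivity
  have hη0 : 0 < η := by rw [hη]; positivity
  refine ⟨b, z, ζ, η, hb0, hz0, hζ0, hη0, ?_⟩
  intro β l hl0 hl hβ1 hβ2 hβ3
  have hβ0 : 0 < β := lt_of_lt_of_le (by positivity) hβ1
  obtain ⟨t, ht⟩ : ∃ t, t = β * L := ⟨_, rfl⟩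
  obtain ⟨s, hs⟩ : ∃ s, s = 1 - l := ⟨_, rfl⟩
  obtain ⟨ρ, hρ⟩ : ∃ ρ, ρ = μ / L := ⟨_, rfl⟩
  have hρ0 : 0 < ρ := by rw [hρ]; positivity
  have hρ1 : ρ ≤ 1 := by rw [hρ]; exact (div_le_one hL).2 hμL
  have ht0 : 0 < t := by rw [ht]; positivity
  have hρs : ρ ≤ s := by rw [hs, hρ]; linarith
  have hs0 : 0 < s := hρ0.trans_le hρs
  have hs1 : s ≤ 1 := by rw [hs]; linarith
  have ht2 : t ≤ s ^ 2 / 192 := by rw [hs, ht]; exact hβ2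
  have ht3 : t ≤ ρ / 382 := by
    rw [ht, hρ]; refine hβ3.trans (le_of_eq ?_); field_simp
  have hβμ : β * μ = t * ρ := by rw [ht, hρ]; field_simp
  have hbL : b * L = ρ / 4 := by rw [hb, hρ]; field_simp
  have hζσ : ζ * σ = ρ / 16 := by rw [hζ, hρ]; field_simp
  have hη1 : η = ρ ^ 3 / 1000 := by rw [hη, hρ]
  have htρ : ρ ^ 2 / 382 ≤ t := by
    rw [ht, hρ]
    calc (μ / L) ^ 2 / 382 = μ ^ 2 / (382 * L ^ 3) * L := by field_simp
      _ ≤ β * L := by gcongr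
  have hηs : η ≤ s / 4 := by
    rw [hη1]
    have : ρ ^ 3 ≤ ρ := by
      calc ρ ^ 3 = ρ * ρ ^ 2 := by ring
        _ ≤ ρ * 1 := by gcongr; exact pow_le_one₀ hρ0.le hρ1
        _ = ρ := mul_one _
    linarith
  -- the weight of `e.y` grows as `β` shrinks, which offsets the factor `2L` in the `w` recursion
  obtain ⟨a, ha⟩ : ∃ a, a = ρ / 4 * s / (2 * t) := ⟨_, rfl⟩
  have ha0 : 0 < a := by rw [ha]; positivity
  have hat : a * t = ρ * s / 8 := by rw [ha]; field_simp; norm_num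
  have haβ : a * β = b * (s / 2) := by
    have : a * β * L = b * (s / 2) * L := by
      calc a * β * L = a * t := by rw [ht]; ring
        _ = b * L * (s / 2) := by rw [hat, hbL]; ring
        _ = _ := by ring
    exact mul_right_cancel₀ hL.ne' this
  have h_dual : (1 - 3 / 4 * (β * μ)) + (b * L + ζ * σ) * (β * L) ≤ 1 - η := by
    rw [hβμ, hbL, hζσ, ← ht, hη1]
    have := mul_le_mul_of_nonneg_right htρ hρ0.le
    have h3 : ρ ^ 3 = ρ ^ 2 * ρ := by ring
    have : 0 ≤ t * ρ := by positivity
    nlinarith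
  have h_y : β * L + a * l + (b * L + ζ * σ) * (2 + β * L) ≤ a * (1 - η) := by
    rw [hbL, hζσ, ← ht]
    have hl' : l = 1 - s := by rw [hs]; ring
    have h1 : a * η ≤ a * (s / 4) := by gcongr
    have h2 : t + (ρ / 4 + ρ / 16) * (2 + t) ≤ a * (3 / 4 * s) := by
      have h3 : a * (3 / 4 * s) = 3 / 32 * ρ * (s ^ 2 / t) := by rw [ha]; field_simp; norm_num
      have h4 : 192 ≤ s ^ 2 / t := by rw [le_div_iff₀ ht0]; linarith
      have h5 : ρ * 192 ≤ ρ * (s ^ 2 / t) := by gcongr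
      have h6 : (ρ / 4 + ρ / 16) * (2 + t) ≤ (ρ / 4 + ρ / 16) * 3 := by
        gcongr; linarith
      rw [h3]; linarith
    rw [hl']
    linarith
  have h_w : a * β + b * l + (b * L + ζ * σ) * β ≤ b * (1 - η) := by
    have h1 : (b * L + ζ * σ) * β = b * (5 / 4 * t) := by
      have : ζ * σ = b * L / 4 := by rw [hbL, hζσ]; ring
      rw [this, ht]; ring
    have h2 : t ≤ s / 192 := by
      have : s ^ 2 ≤ s * 1 := by rw [pow_two]; gcongr
      linarith
    have h3 : s / 2 + l + 5 / 4 * t ≤ 1 - η := by linarith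
    rw [haβ, h1]
    have := mul_le_mul_of_nonneg_left h3 hb0.le
    linarith
  have h_x : z * l + 2 * (b * σ + ζ * L) ≤ z * (1 - η) := by
    have h1 : 2 * (b * σ + ζ * L) = z * (ρ / 2) := by rw [hz, hρ]; field_simp; norm_num
    have h2 : l + ρ / 2 ≤ 1 - η := by linarith
    rw [h1]
    have := mul_le_mul_of_nonneg_left h2 hz0.le
    linarith
  have h_q : ζ * l ≤ ζ * (1 - η) := by gcongr; linarith
  exact ⟨a, ha0, h_dual, h_y, h_w, h_x, h_q⟩

/-- The Lyapunov function decreases at the rate of the slow error, provided `α` is below a bound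
that depends on the five problem constants only: not on `β` and `l` in the stated range. -/
lemma exists_energy_le {L μ σ m K : ℝ} (hμ : 0 < μ) (hμL : μ ≤ L) (hσ : 0 < σ)
    (hm : 0 < m) (hK : 0 < K) :
    ∃ α₀ : ℝ, 0 < α₀ ∧ ∀ α β l : ℝ, 0 < α → α ≤ α₀ → 0 ≤ l → l ≤ 1 - μ / L →
      μ ^ 2 / (382 * L ^ 3) ≤ β → β * L ≤ (1 - l) ^ 2 / 192 → β * L ≤ μ / (382 * L) →
      ∃ A a b z ζ T : ℝ, 0 < A ∧ 0 < a ∧ 0 < b ∧ 0 < z ∧ 0 < ζ ∧ 0 ≤ T ∧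
        ∀ (δ : ℝ) (e e' : Errors), 0 ≤ δ → e.Nonneg → Recursion L μ σ m K α β l δ e e' →
          e'.energy A a b z ζ ≤ (1 - α * m / 2) * e.energy A a b z ζ + T * δ := by
  have hL : 0 < L := hμ.trans_le hμL
  obtain ⟨b, z, ζ, η, hb0, hz0, hζ0, hη0, hweights⟩ := exists_weights hμ hμL hσ
  obtain ⟨K₂, hK₂⟩ : ∃ K₂, K₂ = L / z + σ := ⟨_, rfl⟩
  obtain ⟨K₁, hK₁⟩ : ∃ K₁, K₁ = (σ / μ + b * σ + ζ * L) * (K + K₂) + (z + b * σ + ζ * L) / ζ :=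
    ⟨_, rfl⟩
  have hK₂0 : 0 < K₂ := by rw [hK₂]; positivity
  have hK₁0 : 0 < K₁ := by rw [hK₁]; positivity
  obtain ⟨A, hA⟩ : ∃ A, A = m / (4 * K₁) := ⟨_, rfl⟩
  have hA0 : 0 < A := by rw [hA]; positivity
  refine ⟨A * η / (A * K₁ + K₂ + A * (m / 2)), by positivity, ?_⟩
  intro α β l hα hαle hl0 hl hβ1 hβ2 hβ3
  rw [le_div_iff₀ (by positivity)] at hαle
  have hβ0 : 0 < β := lt_of_lt_of_le (by positivity) hβ1
  obtain ⟨a, ha0, h_dual, h_y, h_w, h_x, h_q⟩ := hweights β l hl0 hl hβ1 hβ2 hβ3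
  have hl1 : l ≤ 1 := hl.trans (by have := div_pos hμ hL; linarith)
  have hAK : A * K₁ ≤ m / 4 := by rw [hA]; apply le_of_eq; field_simp
  refine ⟨A, a, b, z, ζ, α + A * (α * (σ / μ + b * σ + ζ * L)
    + (β + b + ζ + (b * L + ζ * σ) * β)), hA0, ha0, hb0, hz0, hζ0, by positivity, ?_⟩
  intro δ e e' hδ he h
  have hfast := fast_le hL hσ hK hα.le hβ0.le hl1 hδ ha0 hb0 hz0 hζ0 h_dual h_y h_w
    h_x h_q he h
  have hopt := h.opt
  obtain ⟨ho, hd, hx, hq, hy, hw⟩ := he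
  obtain ⟨U, hU⟩ : ∃ U, U = e.fast a b z ζ := ⟨_, rfl⟩
  rw [← hU] at hfast
  have p1 := mul_nonneg ha0.le hy
  have p2 := mul_nonneg hb0.le hw
  have p3 := mul_nonneg hz0.le hx
  have p4 := mul_nonneg hζ0.le hq
  have hU0 : 0 ≤ U := by rw [hU, fast]; linarith
  have hdU : e.dual ≤ U := by rw [hU, fast]; linarith
  have hxU : e.x ≤ U / z := by rw [le_div_iff₀ hz0, hU, fast]; linarith
  have hqU : e.q ≤ U / ζ := by rw [le_div_iff₀ hζ0, hU, fast]; linarith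
  have hslow : L * e.x + σ * e.dual ≤ K₂ * U := by
    calc L * e.x + σ * e.dual ≤ L * (U / z) + σ * U := by gcongr
      _ = K₂ * U := by rw [hK₂]; ring
  have hdrift : e.drift L σ K δ ≤ K * e.opt + K₂ * U + δ := by unfold drift; linarith
  have hK₁' : (σ / μ + b * σ + ζ * L) * e.drift L σ K δ + (z + b * σ + ζ * L) * e.q
      ≤ K₁ * (e.opt + U) + (σ / μ + b * σ + ζ * L) * δ := by
    calc _ ≤ (σ / μ + b * σ + ζ * L) * (K * e.opt + K₂ * U + δ)
          + (z + b * σ + ζ * L) * (U / ζ) := by gcongr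
      _ ≤ (σ / μ + b * σ + ζ * L) * ((K + K₂) * e.opt + (K + K₂) * U + δ)
          + ((z + b * σ + ζ * L) / ζ * e.opt + (z + b * σ + ζ * L) * (U / ζ)) := by
        gcongr
        · linarith
        · linarith
        · have : 0 ≤ (z + b * σ + ζ * L) / ζ * e.opt := by positivity
          linarith
      _ = _ := by rw [hK₁]; ring
  have key := two_time_scale (m := m) (η := η) (K₁ := K₁) (K₂ := K₂) (A := A) (α := α)
    (X := e.opt) (U := U) (X' := e'.opt) (U' := e'.fast a b z ζ) (r := α * δ)
    (s := (α * (σ / μ + b * σ + ζ * L) + (β + b + ζ + (b * L + ζ * σ) * β)) * δ)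
    hA0 hα.le ho hU0 hAK hαle
    (by have := mul_le_mul_of_nonneg_left hslow hα.le; linarith)
    (by have := mul_le_mul_of_nonneg_left hK₁' hα.le; linarith)
  rw [energy, energy, ← hU]
  linarith

end Errors

/-- A sequence that contracts by `ρ` up to a geometrically decaying perturbation, which may
involve the sequence itself at both ends of the step, converges at every rate above `ρ`. -/
lemma geometric_of_perturbed {V : ℕ → ℝ} {ρ ρ' l T : ℝ} (hV : ∀ k, 0 ≤ V k) (hρ : 0 ≤ ρ)
    (hρρ : ρ < ρ') (hl : 0 ≤ l) (hl1 : l < 1) (hlρ : l ≤ ρ') (hT : 0 ≤ T)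
    (h : ∀ k, V (k + 1) ≤ ρ * V k + T * l ^ k * (1 + V k + V (k + 1))) :
    ∃ ψ : ℝ, 0 < ψ ∧ ∀ k, V k ≤ ψ * ρ' ^ k := by
  have hρ'0 : 0 < ρ' := hρ.trans_lt hρρ
  -- once the perturbation factor is at most `d`, one step contracts by `(ρ + d) / (1 - d) < ρ'`
  obtain ⟨d, hd⟩ : ∃ d, d = (ρ' - ρ) / (4 * (1 + ρ')) := ⟨_, rfl⟩
  have hd0 : 0 < d := by rw [hd]; have := sub_pos.2 hρρ; positivity
  have hd1 : d * (1 + ρ') = (ρ' - ρ) / 4 := by rw [hd]; field_simp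
  have hdhalf : d ≤ 1 / 2 := by
    rw [hd, div_le_iff₀ (by positivity)]; linarith
  have hlim : Filter.Tendsto (fun k => T * l ^ k) Filter.atTop (nhds 0) := by
    simpa using (tendsto_pow_atTop_nhds_zero_of_lt_one hl hl1).const_mul T
  obtain ⟨N, hN⟩ := Filter.eventually_atTop.1 (hlim.eventually_le_const hd0)
  obtain ⟨ψ, hψ⟩ : ∃ ψ, ψ = 2 * T / (ρ' - ρ) + ∑ j ∈ Finset.range (N + 1), V j / ρ' ^ j + 1 :=
    ⟨_, rfl⟩
  have hsum : 0 ≤ ∑ j ∈ Finset.range (N + 1), V j / ρ' ^ j :=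
    Finset.sum_nonneg fun j _ => div_nonneg (hV j) (by positivity)
  have hT' : 0 ≤ 2 * T / (ρ' - ρ) := div_nonneg (by positivity) (sub_pos.2 hρρ).le
  have hψ0 : 0 < ψ := by rw [hψ]; linarith
  have hsmall : ∀ k ≤ N, V k ≤ ψ * ρ' ^ k := by
    intro k hk
    rw [← div_le_iff₀ (by positivity)]
    have : V k / ρ' ^ k ≤ ∑ j ∈ Finset.range (N + 1), V j / ρ' ^ j :=
      Finset.single_le_sum (f := fun j => V j / ρ' ^ j)
        (fun j _ => div_nonneg (hV j) (by positivity)) (Finset.mem_range.2 (by omega))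
    linarith
  refine ⟨ψ, hψ0, fun k => ?_⟩
  rcases le_total k N with hk | hk
  · exact hsmall k hk
  induction k, hk using Nat.le_induction with
  | base => exact hsmall N le_rfl
  | succ k hk ih =>
    have h1 := h k
    have h2 := hN k hk
    have h3 := mul_le_mul_of_nonneg_right h2 (hV k)
    have h4 := mul_le_mul_of_nonneg_right h2 (hV (k + 1))
    have h5 : T * l ^ k ≤ T * ρ' ^ k := by gcongr
    have h6 : 2 * T ≤ ψ * (ρ' - ρ) := by
      rw [← div_le_iff₀ (sub_pos.2 hρρ)]; linarith
    have h7 : 2 * T * ρ' ^ k ≤ ψ * (ρ' - ρ) * ρ' ^ k := by gcongr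
    have h8 : V (k + 1) * (1 - d) ≤ (ρ + d) * V k + T * ρ' ^ k := by linarith
    have h9 : (ρ + d) * V k ≤ (ρ + d) * (ψ * ρ' ^ k) := by gcongr
    have h10 : V (k + 1) * (1 - d) ≤ ψ * ρ' ^ (k + 1) * (1 - d) := by
      have h11 : ψ * ρ' ^ (k + 1) * (1 - d) - (ρ + d) * (ψ * ρ' ^ k) - ψ * (ρ' - ρ) / 2 * ρ' ^ k
          = ψ * ρ' ^ k * (ρ' - ρ - d * (1 + ρ') - (ρ' - ρ) / 2) := by ring
      have h12 : 0 ≤ ψ * ρ' ^ k * (ρ' - ρ - d * (1 + ρ') - (ρ' - ρ) / 2) := by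
        rw [hd1]
        have : 0 ≤ ρ' - ρ - (ρ' - ρ) / 4 - (ρ' - ρ) / 2 := by linarith
        positivity
      linarith
    exact le_of_mul_le_mul_right h10 (by linarith)

/-! ### Singular values -/

section SingularValues

variable {E F : Type*} [NormedAddCommGroup E] [InnerProductSpace ℝ E] [FiniteDimensional ℝ E]
  [NormedAddCommGroup F] [InnerProductSpace ℝ F] [FiniteDimensional ℝ F]

lemma sq_norm_apply_eq_sum (T : E →ₗ[ℝ] F) {d : ℕ} (hd : Module.finrank ℝ E = d) (x : E) :
    ‖T x‖ ^ 2 = ∑ i : Fin d, T.singularValues i ^ 2 *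
      ((T.isSymmetric_adjoint_comp_self.eigenvectorBasis hd).repr x i) ^ 2 := by
  have h := T.isSymmetric_adjoint_comp_self
  have h1 : ‖T x‖ ^ 2 = inner ℝ ((LinearMap.adjoint T ∘ₗ T) x) x := by
    rw [LinearMap.comp_apply, LinearMap.adjoint_inner_left, real_inner_self_eq_norm_sq]
  rw [h1, ← (h.eigenvectorBasis hd).repr.inner_map_map, PiLp.inner_apply]
  refine Finset.sum_congr rfl fun i _ => ?_
  rw [h.eigenvectorBasis_apply_self_apply hd, T.sq_singularValues_fin hd]
  simp only [RCLike.ofReal_real_eq_id, id_eq, RCLike.inner_apply, conj_trivial]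
  ring

lemma sq_norm_eq_sum (T : E →ₗ[ℝ] F) {d : ℕ} (hd : Module.finrank ℝ E = d) (x : E) :
    ‖x‖ ^ 2 = ∑ i : Fin d,
      ((T.isSymmetric_adjoint_comp_self.eigenvectorBasis hd).repr x i) ^ 2 := by
  rw [← (T.isSymmetric_adjoint_comp_self.eigenvectorBasis hd).repr.norm_map,
    EuclideanSpace.real_norm_sq_eq]

lemma norm_apply_le_singularValues_zero (T : E →ₗ[ℝ] F) (x : E) :
    ‖T x‖ ≤ T.singularValues 0 * ‖x‖ := by
  have h0 := T.singularValues_nonneg 0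
  refine le_of_sq_le_sq ?_ (by positivity)
  rw [mul_pow, sq_norm_apply_eq_sum T rfl, sq_norm_eq_sum T rfl, Finset.mul_sum]
  refine Finset.sum_le_sum fun i _ => mul_le_mul_of_nonneg_right ?_ (sq_nonneg _)
  exact pow_le_pow_left₀ (T.singularValues_nonneg _) (T.singularValues_antitone (Nat.zero_le _)) 2

lemma singularValues_last_mul_norm_le (T : E →ₗ[ℝ] F) {d : ℕ} (hd : Module.finrank ℝ E = d)
    (x : E) : T.singularValues (d - 1) * ‖x‖ ≤ ‖T x‖ := by
  have h0 := T.singularValues_nonneg (d - 1)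
  refine le_of_sq_le_sq ?_ (by positivity)
  rw [mul_pow, sq_norm_apply_eq_sum T hd, sq_norm_eq_sum T hd, Finset.mul_sum]
  refine Finset.sum_le_sum fun i _ => mul_le_mul_of_nonneg_right ?_ (sq_nonneg _)
  exact pow_le_pow_left₀ h0 (T.singularValues_antitone (by omega)) 2

end SingularValues

/-! ### Strongly monotone operators -/

section Monotone

variable {E : Type*} [NormedAddCommGroup E] [InnerProductSpace ℝ E] {A : E → E} {m K : ℝ}

/-- A short step along a strongly monotone Lipschitz operator is a contraction. -/
lemma norm_step_sub_step_le (hm : 0 < m) (hmK : m ≤ K)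
    (hA : ∀ x y, m * ‖x - y‖ ^ 2 ≤ inner ℝ (A x - A y) (x - y))
    (hK : ∀ x y, ‖A x - A y‖ ≤ K * ‖x - y‖) {a : ℝ} (ha : 0 ≤ a) (haK : a * K ^ 2 ≤ m / 2)
    (x y : E) :
    ‖(x - a • A x) - (y - a • A y)‖ ≤ (1 - 3 / 4 * (a * m)) * ‖x - y‖ := by
  have ham : a * m ≤ 1 / 2 := by
    have h1 : m ^ 2 ≤ K ^ 2 := by gcongr
    have h2 : a * m ^ 2 ≤ a * K ^ 2 := by gcongr
    have h3 : a * m * m ≤ 1 / 2 * m := by linarith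
    exact le_of_mul_le_mul_right h3 hm
  refine le_of_sq_le_sq ?_ (mul_nonneg (by linarith) (norm_nonneg _))
  have h1 : (x - a • A x) - (y - a • A y) = (x - y) - a • (A x - A y) := by
    rw [smul_sub]; abel
  rw [h1, norm_sub_sq_real, real_inner_smul_right, norm_smul, Real.norm_of_nonneg ha,
    real_inner_comm, mul_pow, mul_pow]
  have h2 := mul_le_mul_of_nonneg_left (hA x y) ha
  have h3 : a ^ 2 * ‖A x - A y‖ ^ 2 ≤ a * (m / 2) * ‖x - y‖ ^ 2 := by
    calc a ^ 2 * ‖A x - A y‖ ^ 2 ≤ a ^ 2 * (K * ‖x - y‖) ^ 2 := by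
          gcongr; exact hK x y
      _ = a * (a * K ^ 2) * ‖x - y‖ ^ 2 := by ring
      _ ≤ _ := by gcongr
  have h4 : 0 ≤ (a * m) ^ 2 * ‖x - y‖ ^ 2 := by positivity
  linarith

lemma exists_eq_of_stronglyMonotone [CompleteSpace E] (hm : 0 < m) (hmK : m ≤ K)
    (hA : ∀ x y, m * ‖x - y‖ ^ 2 ≤ inner ℝ (A x - A y) (x - y))
    (hK : ∀ x y, ‖A x - A y‖ ≤ K * ‖x - y‖) (v : E) : ∃ x, A x = v := by
  have hK0 : 0 < K := hm.trans_le hmK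
  obtain ⟨a, ha⟩ : ∃ a, a = m / (2 * K ^ 2) := ⟨_, rfl⟩
  have ha0 : 0 < a := by rw [ha]; positivity
  have haK : a * K ^ 2 = m / 2 := by rw [ha]; field_simp
  have hstep := norm_step_sub_step_le (A := fun x => A x - v) hm hmK
    (fun x y => by simpa using hA x y) (fun x y => by simpa using hK x y) ha0.le haK.le
  have hc : ContractingWith (1 - 3 / 4 * (a * m)).toNNReal (fun x => x - a • (A x - v)) := by
    constructor
    · rw [Real.toNNReal_lt_one]
      have := mul_pos ha0 hm
      linarith
    · refine LipschitzWith.of_dist_le_mul fun x y => ?_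
      rw [dist_eq_norm, dist_eq_norm]
      refine (hstep x y).trans ?_
      gcongr
      exact Real.le_coe_toNNReal _
  have hfix := hc.fixedPoint_isFixedPt
  refine ⟨ContractingWith.fixedPoint _ hc, ?_⟩
  have h1 : a • (A (ContractingWith.fixedPoint _ hc) - v) = 0 := by
    simpa [Function.IsFixedPt] using hfix
  exact sub_eq_zero.1 ((smul_eq_zero.1 h1).resolve_left ha0.ne')

lemma mul_norm_sub_le_of_stronglyMonotone
    (hA : ∀ x y, m * ‖x - y‖ ^ 2 ≤ inner ℝ (A x - A y) (x - y)) (x y : E) :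
    m * ‖x - y‖ ≤ ‖A x - A y‖ := by
  rcases (norm_nonneg (x - y)).eq_or_lt with h | h
  · rw [← h]; simp
  · have h1 := (hA x y).trans (real_inner_le_norm _ _)
    refine le_of_mul_le_mul_right ?_ h
    linarith

end Monotone

/-! ### Gradients of smooth convex functions -/

section Gradient

variable {E : Type*} [NormedAddCommGroup E] [InnerProductSpace ℝ E] [CompleteSpace E]

lemma hasGradientAt_add {f g : E → ℝ} {f' g' x : E} (hf : HasGradientAt f f' x)
    (hg : HasGradientAt g g' x) : HasGradientAt (fun z => f z + g z) (f' + g') x := by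
  rw [hasGradientAt_iff_hasFDerivAt, map_add]
  exact hf.hasFDerivAt.add hg.hasFDerivAt

lemma hasGradientAt_sub {f g : E → ℝ} {f' g' x : E} (hf : HasGradientAt f f' x)
    (hg : HasGradientAt g g' x) : HasGradientAt (fun z => f z - g z) (f' - g') x := by
  rw [hasGradientAt_iff_hasFDerivAt, map_sub]
  exact hf.hasFDerivAt.sub hg.hasFDerivAt

lemma hasGradientAt_const (c : ℝ) (x : E) : HasGradientAt (fun _ : E => c) 0 x := by
  rw [hasGradientAt_iff_hasFDerivAt, map_zero]
  exact hasFDerivAt_const c x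

lemma hasGradientAt_inner (v x : E) : HasGradientAt (fun z => inner ℝ v z) v x := by
  rw [hasGradientAt_iff_hasFDerivAt]
  exact (InnerProductSpace.toDual ℝ E v).hasFDerivAt

lemma hasGradientAt_average {n : ℕ} {f : Fin n → E → ℝ} {f' : Fin n → E} {x : E}
    (h : ∀ i, HasGradientAt (f i) (f' i) x) : HasGradientAt (average f) (average f') x := by
  rw [hasGradientAt_iff_hasFDerivAt, average, average, map_smul, map_sum]
  exact (HasFDerivAt.sum fun i _ => (h i).hasFDerivAt).const_smul _

/-- The first-order condition for convexity. -/
lemma ConvexOn.add_inner_gradient_le {f : E → ℝ} (hf : ConvexOn ℝ Set.univ f) {f' y : E}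
    (h : HasGradientAt f f' y) (x : E) : f y + inner ℝ f' (x - y) ≤ f x := by
  have hline : ConvexOn ℝ Set.univ (f ∘ AffineMap.lineMap (k := ℝ) y x) :=
    hf.comp_affineMap (AffineMap.lineMap (k := ℝ) y x)
  have hderiv : HasDerivAt (f ∘ AffineMap.lineMap (k := ℝ) y x) (inner ℝ f' (x - y)) 0 := by
    have h1 : HasDerivAt (AffineMap.lineMap (k := ℝ) y x) (x - y) (0 : ℝ) :=
      AffineMap.hasDerivAt_lineMap
    have h2 : HasFDerivAt f (InnerProductSpace.toDual ℝ E f')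
        (AffineMap.lineMap (k := ℝ) y x (0 : ℝ)) := by
      rw [AffineMap.lineMap_apply_zero]; exact h.hasFDerivAt
    exact h2.comp_hasDerivAt (0 : ℝ) h1
  have := hline.le_slope_of_hasDerivAt (Set.mem_univ 0) (Set.mem_univ 1) one_pos hderiv
  rw [slope_def_field] at this
  simp at this
  linarith

lemma eq_zero_of_forall_le {f : E → ℝ} {f' x : E} (h : HasGradientAt f f' x)
    (hmin : ∀ z, f x ≤ f z) : f' = 0 := by
  have h1 : IsLocalMin f x := Filter.Eventually.of_forall hmin
  have := h1.hasFDerivAt_eq_zero h.hasFDerivAt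
  simpa using this

end Gradient

/-! ### The saddle point -/

section Saddle

variable {px py : ℕ}

lemma inner_toEuclideanLin_conjTranspose (P : Matrix (Fin py) (Fin px) ℝ) (x : Vec px)
    (y : Vec py) :
    inner ℝ (Matrix.toEuclideanLin P.conjTranspose y) x
      = inner ℝ y (Matrix.toEuclideanLin P x) := by
  rw [Matrix.toEuclideanLin_conjTranspose_eq_adjoint, LinearMap.adjoint_inner_left]

lemma hasGradientAt_cost_left {g : Vec px → ℝ} {g' x : Vec px} (hg : HasGradientAt g g' x)
    (h : Vec py → ℝ) (P : Matrix (Fin py) (Fin px) ℝ) (y : Vec py) :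
    HasGradientAt (fun x' => cost g h P x' y) (g' + Matrix.toEuclideanLin P.conjTranspose y) x := by
  have := hasGradientAt_sub (hasGradientAt_add hg
    (hasGradientAt_inner (Matrix.toEuclideanLin P.conjTranspose y) x)) (hasGradientAt_const (h y) x)
  simpa only [cost, inner_toEuclideanLin_conjTranspose, sub_zero] using this

lemma hasGradientAt_cost_right (g : Vec px → ℝ) {h : Vec py → ℝ} {h' y : Vec py}
    (hh : HasGradientAt h h' y) (P : Matrix (Fin py) (Fin px) ℝ) (x : Vec px) :
    HasGradientAt (fun y' => cost g h P x y') (Matrix.toEuclideanLin P x - h') y := by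
  have := hasGradientAt_sub (hasGradientAt_add (hasGradientAt_const (g x) y)
    (hasGradientAt_inner (Matrix.toEuclideanLin P x) y)) hh
  simpa only [cost, real_inner_comm, zero_add] using this

/-- A saddle point problem in terms of its gradients `G'`, `H'` and coupling matrix `P`. -/
structure SaddleOperators (G' : Vec px → Vec px) (H' : Vec py → Vec py)
    (P : Matrix (Fin py) (Fin px) ℝ) (L μ σm σM : ℝ) : Prop where
  mu_pos : 0 < μ
  sigmaMin_pos : 0 < σm
  mu_le : μ ≤ L
  sigmaMin_le : σm ≤ σM
  lipschitz_G : ∀ x x', ‖G' x - G' x'‖ ≤ L * ‖x - x'‖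
  monotone_G : ∀ x x', 0 ≤ inner ℝ (G' x - G' x') (x - x')
  lipschitz_H : ∀ y y', ‖H' y - H' y'‖ ≤ L * ‖y - y'‖
  monotone_H : ∀ y y', μ * ‖y - y'‖ ^ 2 ≤ inner ℝ (H' y - H' y') (y - y')
  norm_le : ∀ x, ‖Matrix.toEuclideanLin P x‖ ≤ σM * ‖x‖
  le_norm : ∀ x, σm * ‖x‖ ≤ ‖Matrix.toEuclideanLin P x‖

namespace SaddleOperators

variable {G' : Vec px → Vec px} {H' : Vec py → Vec py} {P : Matrix (Fin py) (Fin px) ℝ}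
  {L μ σm σM : ℝ}

lemma norm_conjTranspose_le (S : SaddleOperators G' H' P L μ σm σM) (y : Vec py) :
    ‖Matrix.toEuclideanLin P.conjTranspose y‖ ≤ σM * ‖y‖ := by
  set z := Matrix.toEuclideanLin P.conjTranspose y with hz
  have hσ := S.sigmaMin_pos.trans_le S.sigmaMin_le
  rcases (norm_nonneg z).eq_or_lt with h | h
  · rw [← h]; positivity
  · refine le_of_mul_le_mul_right ?_ h
    calc ‖z‖ * ‖z‖ = inner ℝ y (Matrix.toEuclideanLin P z) := by
          rw [← inner_toEuclideanLin_conjTranspose, ← hz, real_inner_self_eq_norm_mul_norm]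
      _ ≤ ‖y‖ * (σM * ‖z‖) := (real_inner_le_norm _ _).trans (by gcongr; exact S.norm_le z)
      _ = _ := by ring

/-- The inner maximization over `y` has a solution that depends Lipschitz continuously on `x`. -/
lemma exists_maximizer (S : SaddleOperators G' H' P L μ σm σM) :
    ∃ Y : Vec px → Vec py, (∀ x, H' (Y x) = Matrix.toEuclideanLin P x) ∧
      ∀ x x', ‖Y x - Y x'‖ ≤ σM / μ * ‖x - x'‖ := by
  choose Y hY using fun x => exists_eq_of_stronglyMonotone S.mu_pos S.mu_le S.monotone_H
    S.lipschitz_H (Matrix.toEuclideanLin P x)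
  refine ⟨Y, hY, fun x x' => ?_⟩
  have h1 := mul_norm_sub_le_of_stronglyMonotone S.monotone_H (Y x) (Y x')
  rw [hY, hY, ← map_sub] at h1
  have h2 := h1.trans (S.norm_le _)
  have hμ := S.mu_pos
  rw [div_mul_eq_mul_div, le_div_iff₀ hμ]
  linarith

section Primal

variable {Y : Vec px → Vec py}

/-- The gradient `x ↦ G'(x) + Pᵀ Y(x)` of the primal function is Lipschitz. -/
lemma lipschitz_primal (S : SaddleOperators G' H' P L μ σm σM)
    (hY : ∀ x x', ‖Y x - Y x'‖ ≤ σM / μ * ‖x - x'‖) (x x' : Vec px) :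
    ‖(G' x + Matrix.toEuclideanLin P.conjTranspose (Y x))
      - (G' x' + Matrix.toEuclideanLin P.conjTranspose (Y x'))‖
      ≤ (L + σM ^ 2 / μ) * ‖x - x'‖ := by
  have hσ := S.sigmaMin_pos.trans_le S.sigmaMin_le
  rw [add_sub_add_comm, ← map_sub]
  calc _ ≤ L * ‖x - x'‖ + σM * (σM / μ * ‖x - x'‖) := by
        refine (norm_add_le _ _).trans (add_le_add (S.lipschitz_G x x') ?_)
        exact (S.norm_conjTranspose_le _).trans (by gcongr; exact hY x x')
    _ = _ := by ring

/-- The primal function is strongly convex although `G` need not be: `P` has trivial kernel, and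
its composition with the inverse of the strongly monotone Lipschitz operator `H'` is strongly
monotone. -/
lemma monotone_primal (S : SaddleOperators G' H' P L μ σm σM)
    (hY : ∀ x, H' (Y x) = Matrix.toEuclideanLin P x) (x x' : Vec px) :
    μ * σm ^ 2 / L ^ 2 * ‖x - x'‖ ^ 2 ≤
      inner ℝ ((G' x + Matrix.toEuclideanLin P.conjTranspose (Y x))
        - (G' x' + Matrix.toEuclideanLin P.conjTranspose (Y x'))) (x - x') := by
  have hμ := S.mu_pos
  have hσ := S.sigmaMin_pos
  have hL : 0 < L := hμ.trans_le S.mu_le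
  rw [add_sub_add_comm, ← map_sub, inner_add_left, inner_toEuclideanLin_conjTranspose, map_sub,
    ← hY, ← hY]
  have h1 := S.monotone_G x x'
  have h2 := S.monotone_H (Y x) (Y x')
  have h3 := S.lipschitz_H (Y x) (Y x')
  rw [hY, hY, ← map_sub] at h3
  have h4 := (S.le_norm _).trans h3
  have h5 : μ * σm ^ 2 / L ^ 2 * ‖x - x'‖ ^ 2 ≤ μ * ‖Y x - Y x'‖ ^ 2 := by
    calc μ * σm ^ 2 / L ^ 2 * ‖x - x'‖ ^ 2 = μ / L ^ 2 * (σm * ‖x - x'‖) ^ 2 := by ring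
      _ ≤ μ / L ^ 2 * (L * ‖Y x - Y x'‖) ^ 2 := by gcongr
      _ = _ := by field_simp
  have h6 := real_inner_comm (Y x - Y x') (H' (Y x) - H' (Y x'))
  linarith

lemma primal_const_le (S : SaddleOperators G' H' P L μ σm σM) :
    μ * σm ^ 2 / L ^ 2 ≤ L + σM ^ 2 / μ := by
  have hμ := S.mu_pos
  have hσ := S.sigmaMin_pos
  have hL : 0 < L := hμ.trans_le S.mu_le
  have h1 := S.mu_le
  have h2 := S.sigmaMin_le
  calc μ * σm ^ 2 / L ^ 2 ≤ μ * σM ^ 2 / μ ^ 2 := by gcongr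
    _ = σM ^ 2 / μ := by field_simp
    _ ≤ _ := by linarith

lemma exists_primal_eq_zero (S : SaddleOperators G' H' P L μ σm σM)
    (hY : ∀ x, H' (Y x) = Matrix.toEuclideanLin P x)
    (hYL : ∀ x x', ‖Y x - Y x'‖ ≤ σM / μ * ‖x - x'‖) :
    ∃ x, G' x + Matrix.toEuclideanLin P.conjTranspose (Y x) = 0 := by
  have hμ := S.mu_pos
  have hσ := S.sigmaMin_pos
  have hL : 0 < L := hμ.trans_le S.mu_le
  exact exists_eq_of_stronglyMonotone (by positivity) S.primal_const_le (S.monotone_primal hY)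
    (S.lipschitz_primal hYL) 0

end Primal

/-- The system `G'(x) + Pᵀ y = 0`, `H'(y) = P x` has at most one solution. -/
lemma eq_and_eq_of_stationary (S : SaddleOperators G' H' P L μ σm σM) {x x' : Vec px}
    {y y' : Vec py} (h1 : G' x + Matrix.toEuclideanLin P.conjTranspose y = 0)
    (h2 : H' y = Matrix.toEuclideanLin P x)
    (h1' : G' x' + Matrix.toEuclideanLin P.conjTranspose y' = 0)
    (h2' : H' y' = Matrix.toEuclideanLin P x') : x = x' ∧ y = y' := by
  obtain ⟨Y, hY, -⟩ := S.exists_maximizer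
  have hμ := S.mu_pos
  have hσ := S.sigmaMin_pos
  have hL : 0 < L := hμ.trans_le S.mu_le
  have hinj : ∀ z z', H' z = H' z' → z = z' := by
    intro z z' hz
    have := mul_norm_sub_le_of_stronglyMonotone S.monotone_H z z'
    rw [hz, sub_self, norm_zero] at this
    exact sub_eq_zero.1 (norm_le_zero_iff.1 (nonpos_of_mul_nonpos_right this hμ))
  have hy : y = Y x := hinj _ _ (h2.trans (hY x).symm)
  have hy' : y' = Y x' := hinj _ _ (h2'.trans (hY x').symm)
  have hx : x = x' := by
    have := mul_norm_sub_le_of_stronglyMonotone (S.monotone_primal hY) x x'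
    rw [← hy, ← hy', h1, h1', sub_self, norm_zero] at this
    exact sub_eq_zero.1 (norm_le_zero_iff.1 (nonpos_of_mul_nonpos_right this (by positivity)))
  exact ⟨hx, by rw [hy, hy', hx]⟩

end SaddleOperators

end Saddle

section ProblemSaddle

variable {n px py : ℕ} {prob : Problem n px py}

lemma Problem.F_eq_cost (x : Vec px) (y : Vec py) :
    prob.F x y = cost prob.G prob.H prob.Pbar x y := by
  have h1 : prob.G x = average fun i => prob.g i x := by simp [Problem.G, average]
  have h2 : prob.H y = average fun i => prob.h i y := by simp [Problem.H, average]
  have h3 : inner ℝ y (Matrix.toEuclideanLin prob.Pbar x)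
      = average fun i => inner ℝ y (Matrix.toEuclideanLin (prob.P i) x) := by
    simp [Problem.Pbar, average, inner_smul_right, inner_sum]
  simp only [Problem.F, cost, h1, h2, h3]
  rw [average_sub, average_add]

/-- For a convex `G` and a concave `-H`, saddle points are the stationary points. -/
lemma Problem.isSaddle_iff {G' : Vec px → Vec px} {H' : Vec py → Vec py}
    (hG' : ∀ x, HasGradientAt prob.G (G' x) x) (hH' : ∀ y, HasGradientAt prob.H (H' y) y)
    (hG : ∀ x x', prob.G x + inner ℝ (G' x) (x' - x) ≤ prob.G x')
    (hH : ∀ y y', prob.H y + inner ℝ (H' y) (y' - y) ≤ prob.H y') (x : Vec px) (y : Vec py) :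
    prob.IsSaddle x y ↔ G' x + Matrix.toEuclideanLin prob.Pbar.conjTranspose y = 0 ∧
      H' y = Matrix.toEuclideanLin prob.Pbar x := by
  have hF := Problem.F_eq_cost (prob := prob)
  constructor
  · intro h
    constructor
    · refine eq_zero_of_forall_le (hasGradientAt_cost_left (hG' x) prob.H prob.Pbar y) fun z => ?_
      rw [← hF, ← hF]
      exact h z (Set.mem_univ _) y (Set.mem_univ _)
    · have := hasGradientAt_sub (hasGradientAt_const 0 y)
        (hasGradientAt_cost_right prob.G (hH' y) prob.Pbar x)
      have h0 := eq_zero_of_forall_le this fun z => by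
        have h1 := h x (Set.mem_univ _) z (Set.mem_univ _)
        rw [hF, hF] at h1
        linarith
      rw [zero_sub, neg_sub, sub_eq_zero] at h0
      exact h0
  · rintro ⟨h1, h2⟩ x' - y' -
    rw [hF, hF, cost, cost]
    have e1 := hG x x'
    have e2 := hH y y'
    rw [eq_neg_of_add_eq_zero_left h1, inner_neg_left, inner_toEuclideanLin_conjTranspose, map_sub,
      inner_sub_right] at e1
    rw [h2, inner_sub_right, real_inner_comm, real_inner_comm y] at e2
    linarith

end ProblemSaddle

/-! ### One iteration of GT-GDA -/

section Iteration

variable {n px py : ℕ} {prob : Problem n px py} {W : Matrix (Fin n) (Fin n) ℝ} {α β : ℝ}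

/-- The average over the nodes of the gradients of the `gᵢ`. -/
def Problem.gradG (prob : Problem n px py) (x : Vec px) : Vec px :=
  average fun i => gradient (prob.g i) x

/-- The average over the nodes of the gradients of the `hᵢ`. -/
def Problem.gradH (prob : Problem n px py) (y : Vec py) : Vec py :=
  average fun i => gradient (prob.h i) y

/-- The error in the partial gradients in `x` from using `Pᵢᵏ` instead of `P̄`. -/
def State.couplingX (prob : Problem n px py) (s : State n px py) (i : Fin n) : Vec px :=
  Matrix.toEuclideanLin (s.P i - prob.Pbar).conjTranspose (s.y i)

/-- The error in the partial gradients in `y` from using `Pᵢᵏ` instead of `P̄`. -/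
def State.couplingY (prob : Problem n px py) (s : State n px py) (i : Fin n) : Vec py :=
  Matrix.toEuclideanLin (s.P i - prob.Pbar) (s.x i)

/-- The size of the errors caused by the disagreement about the coupling matrix. -/
def State.disagreement (prob : Problem n px py) (s : State n px py) : ℝ :=
  stackNorm (s.couplingX prob) + stackNorm (s.couplingY prob)

/-- The error quantities of a state with respect to the minimizer `xs` of the primal function,
where `Y x` is the maximizer over `y` for given `x`. -/
def State.errors (s : State n px py) (xs : Vec px) (Y : Vec px → Vec py) : Errors where
  opt := √n * ‖average s.x - xs‖
  dual := √n * ‖average s.y - Y (average s.x)‖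
  x := stackNorm (dev s.x)
  q := stackNorm (dev s.q)
  y := stackNorm (dev s.y)
  w := stackNorm (dev s.w)

lemma State.errors_nonneg (s : State n px py) (xs : Vec px) (Y : Vec px → Vec py) :
    (s.errors xs Y).Nonneg where
  opt := by unfold State.errors; positivity
  dual := by unfold State.errors; positivity
  x := stackNorm_nonneg _
  q := stackNorm_nonneg _
  y := stackNorm_nonneg _
  w := stackNorm_nonneg _

lemma State.disagreement_nonneg (s : State n px py) : 0 ≤ s.disagreement prob :=
  add_nonneg (stackNorm_nonneg _) (stackNorm_nonneg _)

lemma gradX_eq (hg : ∀ i, Differentiable ℝ (prob.g i)) (s : State n px py) (i : Fin n) :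
    gradX prob s.P s.x s.y i = gradient (prob.g i) (s.x i)
      + Matrix.toEuclideanLin prob.Pbar.conjTranspose (s.y i) + s.couplingX prob i := by
  rw [gradX, (hasGradientAt_cost_left (hg i (s.x i)).hasGradientAt _ _ _).gradient,
    State.couplingX, Matrix.conjTranspose_sub, map_sub, LinearMap.sub_apply]
  abel

lemma gradY_eq (hh : ∀ i, Differentiable ℝ (prob.h i)) (s : State n px py) (i : Fin n) :
    gradY prob s.P s.x s.y i = Matrix.toEuclideanLin prob.Pbar (s.x i)
      - gradient (prob.h i) (s.y i) + s.couplingY prob i := by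
  rw [gradY, (hasGradientAt_cost_right _ (hh i (s.y i)).hasGradientAt _ _).gradient,
    State.couplingY, map_sub, LinearMap.sub_apply]
  abel

/-- Gradient tracking: the trackers average to the average of the current local gradients. -/
structure State.Tracks (prob : Problem n px py) (s : State n px py) : Prop where
  q : average s.q = average (gradX prob s.P s.x s.y)
  w : average s.w = average (gradY prob s.P s.x s.y)

lemma State.Tracks.step (hW : W ∈ doublyStochastic ℝ (Fin n)) {s : State n px py}
    (h : s.Tracks prob) : (step prob W α β s).Tracks prob where
  q := by
    simp only [GTGDA.step]
    rw [average_mix hW, average_sub, average_add, h.q]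
    exact add_sub_cancel_left _ _
  w := by
    simp only [GTGDA.step]
    rw [average_mix hW, average_sub, average_add, h.w]
    exact add_sub_cancel_left _ _

lemma tracks_iterate (hW : W ∈ doublyStochastic ℝ (Fin n)) (x₀ : Fin n → Vec px)
    (y₀ : Fin n → Vec py) (k : ℕ) : (iterate prob W α β x₀ y₀ k).Tracks prob := by
  induction k with
  | zero => exact ⟨rfl, rfl⟩
  | succ k ih =>
    rw [iterate, Function.iterate_succ_apply']
    exact ih.step hW

lemma stackNorm_sub_average_le {p : ℕ} {f : Fin n → Vec p → Vec p} {L : ℝ} (hL : 0 ≤ L)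
    (hf : ∀ i v v', ‖f i v - f i v'‖ ≤ L * ‖v - v'‖) (v : Fin n → Vec p) :
    √n * ‖average (fun i => f i (v i)) - average (fun i => f i (average v))‖
      ≤ L * stackNorm (dev v) := by
  rw [← average_sub]
  exact (sqrt_mul_norm_average_le _).trans (stackNorm_le_of_norm_le hL fun i => hf i _ _)

/-- A stacked vector moves by its change of average plus the deviations at both ends. -/
lemma stackNorm_move_le {p : ℕ} (v v' : Fin n → Vec p) :
    stackNorm (fun i => v' i - v i)
      ≤ stackNorm (dev v') + stackNorm (dev v) + √n * ‖average v' - average v‖ := by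
  refine (stackNorm_le_dev_add _).trans ?_
  rw [average_sub]
  have : dev (fun i => v' i - v i) = fun i => dev v' i - dev v i := by
    funext i; simp only [dev, average_sub]; abel
  rw [this]
  gcongr
  exact stackNorm_sub_le _ _

/-- Consensus error of a tracker after one iteration. -/
lemma stackNorm_dev_track_le {p : ℕ} (hW : W ∈ doublyStochastic ℝ (Fin n))
    (v d d' : Fin n → Vec p) :
    stackNorm (dev (mix W fun r => v r + d' r - d r))
      ≤ lam W * (stackNorm (dev v) + stackNorm fun r => d' r - d r) := by
  refine (stackNorm_dev_mix_le hW _).trans (mul_le_mul_of_nonneg_left ?_ (lam_nonneg W))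
  have : dev (fun r => v r + d' r - d r) = fun r => dev v r + dev (fun r => d' r - d r) r := by
    funext i; simp only [dev, average_sub, average_add]; abel
  rw [this]
  refine (stackNorm_add_le _ _).trans ?_
  gcongr
  exact stackNorm_dev_le _

section Recursion

variable {L μ σm σM : ℝ} {Y : Vec px → Vec py} {xs : Vec px}

/-- The assumptions under which one iteration is analysed. -/
structure Setting (prob : Problem n px py) (W : Matrix (Fin n) (Fin n) ℝ) (L μ σm σM : ℝ)
    (Y : Vec px → Vec py) (xs : Vec px) : Prop where
  ops : SaddleOperators prob.gradG prob.gradH prob.Pbar L μ σm σM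
  smooth_g : ∀ i, IsSmooth L (prob.g i)
  smooth_h : ∀ i, IsSmooth L (prob.h i)
  stochastic : W ∈ doublyStochastic ℝ (Fin n)
  lam_lt : lam W < 1
  maximizer : ∀ x, prob.gradH (Y x) = Matrix.toEuclideanLin prob.Pbar x
  lipschitz : ∀ x x', ‖Y x - Y x'‖ ≤ σM / μ * ‖x - x'‖
  stationary : prob.gradG xs + Matrix.toEuclideanLin prob.Pbar.conjTranspose (Y xs) = 0

namespace Setting

lemma L_pos (A : Setting prob W L μ σm σM Y xs) : 0 < L := A.ops.mu_pos.trans_le A.ops.mu_le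

lemma sigmaMax_pos (A : Setting prob W L μ σm σM Y xs) : 0 < σM :=
  A.ops.sigmaMin_pos.trans_le A.ops.sigmaMin_le

/-- The average gradient in `x` is the gradient of the primal function up to the errors. -/
lemma average_gradX_le (A : Setting prob W L μ σm σM Y xs) (s : State n px py) :
    √n * ‖average (gradX prob s.P s.x s.y) - (prob.gradG (average s.x)
        + Matrix.toEuclideanLin prob.Pbar.conjTranspose (Y (average s.x)))‖
      ≤ L * (s.errors xs Y).x + σM * (s.errors xs Y).dual + s.disagreement prob := by
  have h1 : average (gradX prob s.P s.x s.y) - (prob.gradG (average s.x)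
        + Matrix.toEuclideanLin prob.Pbar.conjTranspose (Y (average s.x)))
      = (average (fun i => gradient (prob.g i) (s.x i))
          - average (fun i => gradient (prob.g i) (average s.x)))
        + Matrix.toEuclideanLin prob.Pbar.conjTranspose (average s.y - Y (average s.x))
        + average (s.couplingX prob) := by
    rw [show gradX prob s.P s.x s.y = fun i => _ from
      funext (gradX_eq (fun i => (A.smooth_g i).1) s), average_add, average_add, map_sub,
      map_average, Problem.gradG]
    abel
  rw [h1]
  have h2 := stackNorm_sub_average_le A.L_pos.le (fun i => (A.smooth_g i).2) s.x
  have h3 := mul_le_mul_of_nonneg_left (A.ops.norm_conjTranspose_le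
    (average s.y - Y (average s.x))) (Real.sqrt_nonneg n)
  have h4 := sqrt_mul_norm_average_le (s.couplingX prob)
  have h5 := stackNorm_nonneg (s.couplingY prob)
  refine (mul_le_mul_of_nonneg_left (norm_add₃_le ..) (Real.sqrt_nonneg n)).trans ?_
  simp only [State.errors, State.disagreement]
  linarith

/-- The average gradient in `y` is the gradient at the averages up to the errors. -/
lemma average_gradY_le (A : Setting prob W L μ σm σM Y xs) (s : State n px py) :
    √n * ‖average (gradY prob s.P s.x s.y)
        - (Matrix.toEuclideanLin prob.Pbar (average s.x) - prob.gradH (average s.y))‖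
      ≤ L * (s.errors xs Y).y + s.disagreement prob := by
  have h1 : average (gradY prob s.P s.x s.y)
        - (Matrix.toEuclideanLin prob.Pbar (average s.x) - prob.gradH (average s.y))
      = average (s.couplingY prob) - (average (fun i => gradient (prob.h i) (s.y i))
          - average (fun i => gradient (prob.h i) (average s.y))) := by
    rw [show gradY prob s.P s.x s.y = fun i => _ from
      funext (gradY_eq (fun i => (A.smooth_h i).1) s), average_add, average_sub, map_average,
      Problem.gradH]
    abel
  rw [h1]
  have h2 := stackNorm_sub_average_le A.L_pos.le (fun i => (A.smooth_h i).2) s.y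
  have h4 := sqrt_mul_norm_average_le (s.couplingY prob)
  have h5 := stackNorm_nonneg (s.couplingX prob)
  refine (mul_le_mul_of_nonneg_left (norm_sub_le ..) (Real.sqrt_nonneg n)).trans ?_
  simp only [State.errors, State.disagreement]
  linarith

lemma norm_average_q_le (A : Setting prob W L μ σm σM Y xs) {s : State n px py}
    (hs : s.Tracks prob) : √n * ‖average s.q‖
      ≤ (s.errors xs Y).drift L σM (L + σM ^ 2 / μ) (s.disagreement prob) := by
  have h1 := A.average_gradX_le s
  have h2 := mul_le_mul_of_nonneg_left (A.ops.lipschitz_primal A.lipschitz (average s.x) xs)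
    (Real.sqrt_nonneg n)
  rw [A.stationary, sub_zero] at h2
  rw [← hs.q] at h1
  have h3 := mul_le_mul_of_nonneg_left (norm_le_norm_sub_add (average s.q)
    (prob.gradG (average s.x)
        + Matrix.toEuclideanLin prob.Pbar.conjTranspose (Y (average s.x)))) (Real.sqrt_nonneg n)
  have h4 : (s.errors xs Y).opt = √n * ‖average s.x - xs‖ := rfl
  rw [Errors.drift, h4]
  linarith

lemma norm_average_w_le (A : Setting prob W L μ σm σM Y xs) {s : State n px py}
    (hs : s.Tracks prob) : √n * ‖average s.w‖
      ≤ L * ((s.errors xs Y).dual + (s.errors xs Y).y) + s.disagreement prob := by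
  have h1 := A.average_gradY_le s
  have h2 := mul_le_mul_of_nonneg_left (A.ops.lipschitz_H (average s.y) (Y (average s.x)))
    (Real.sqrt_nonneg n)
  rw [A.maximizer, norm_sub_rev] at h2
  rw [← hs.w] at h1
  have h3 := mul_le_mul_of_nonneg_left (norm_le_norm_sub_add (average s.w)
    (Matrix.toEuclideanLin prob.Pbar (average s.x) - prob.gradH (average s.y)))
    (Real.sqrt_nonneg n)
  have h4 : (s.errors xs Y).dual = √n * ‖average s.y - Y (average s.x)‖ := rfl
  rw [h4]
  linarith

lemma average_x_step (A : Setting prob W L μ σm σM Y xs) (s : State n px py) :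
    average (step prob W α β s).x = average s.x - α • average s.q := by
  simp only [step]
  rw [average_mix A.stochastic, average_sub, average_smul]

lemma average_y_step (A : Setting prob W L μ σm σM Y xs) (s : State n px py) :
    average (step prob W α β s).y = average s.y + β • average s.w := by
  simp only [step]
  rw [average_mix A.stochastic, average_add, average_smul]

lemma opt_step_le (A : Setting prob W L μ σm σM Y xs) {s : State n px py} (hs : s.Tracks prob)
    (hα : 0 ≤ α) (hαK : α * (L + σM ^ 2 / μ) ^ 2 ≤ μ * σm ^ 2 / L ^ 2 / 2) :
    ((step prob W α β s).errors xs Y).opt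
      ≤ (1 - 3 / 4 * (α * (μ * σm ^ 2 / L ^ 2))) * (s.errors xs Y).opt
        + α * (L * (s.errors xs Y).x + σM * (s.errors xs Y).dual + s.disagreement prob) := by
  have hμ := A.ops.mu_pos
  have hσ := A.ops.sigmaMin_pos
  have hL := A.L_pos
  have h1 := A.average_gradX_le s
  rw [← hs.q] at h1
  have h2 := norm_step_sub_step_le (by positivity) A.ops.primal_const_le
    (A.ops.monotone_primal A.maximizer) (A.ops.lipschitz_primal A.lipschitz) hα hαK
    (average s.x) xs
  rw [A.stationary, smul_zero, sub_zero] at h2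
  set D := prob.gradG (average s.x)
        + Matrix.toEuclideanLin prob.Pbar.conjTranspose (Y (average s.x))
  have h3 : average (step prob W α β s).x - xs
      = (average s.x - α • D - xs) - α • (average s.q - D) := by
    rw [A.average_x_step, smul_sub]; abel
  have h4 := norm_sub_le (average s.x - α • D - xs) (α • (average s.q - D))
  rw [← h3, norm_smul, Real.norm_of_nonneg hα] at h4
  have h5 := mul_le_mul_of_nonneg_left (h4.trans (add_le_add_left h2 _)) (Real.sqrt_nonneg n)
  have h6 := mul_le_mul_of_nonneg_left h1 hα
  have h7 : (s.errors xs Y).opt = √n * ‖average s.x - xs‖ := rfl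
  have h8 : ((step prob W α β s).errors xs Y).opt
      = √n * ‖average (step prob W α β s).x - xs‖ := rfl
  rw [h7, h8]
  linarith

lemma norm_average_x_move_le (A : Setting prob W L μ σm σM Y xs) {s : State n px py}
    (hs : s.Tracks prob) (hα : 0 ≤ α) :
    √n * ‖average (step prob W α β s).x - average s.x‖
      ≤ α * (s.errors xs Y).drift L σM (L + σM ^ 2 / μ) (s.disagreement prob) := by
  rw [A.average_x_step, sub_sub_cancel_left, norm_neg, norm_smul, Real.norm_of_nonneg hα,
    mul_left_comm]
  exact mul_le_mul_of_nonneg_left (A.norm_average_q_le hs) hα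

lemma dual_step_le (A : Setting prob W L μ σm σM Y xs) {s : State n px py} (hs : s.Tracks prob)
    (hα : 0 ≤ α) (hβ : 0 ≤ β) (hβL : β * L ^ 2 ≤ μ / 2) :
    ((step prob W α β s).errors xs Y).dual
      ≤ (1 - 3 / 4 * (β * μ)) * (s.errors xs Y).dual
        + β * (L * (s.errors xs Y).y + s.disagreement prob)
        + σM / μ * (α * (s.errors xs Y).drift L σM (L + σM ^ 2 / μ) (s.disagreement prob)) := by
  have hμ := A.ops.mu_pos
  have hσ := A.sigmaMax_pos
  have h1 := A.average_gradY_le s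
  rw [← hs.w, ← A.maximizer] at h1
  have h2 := norm_step_sub_step_le hμ A.ops.mu_le A.ops.monotone_H A.ops.lipschitz_H hβ hβL
    (average s.y) (Y (average s.x))
  have h3 := A.lipschitz (average s.x) (average (step prob W α β s).x)
  rw [norm_sub_rev (average s.x)] at h3
  set D := prob.gradH (Y (average s.x)) - prob.gradH (average s.y) with hD
  have h4 : average (step prob W α β s).y - Y (average (step prob W α β s).x)
      = ((average s.y - β • prob.gradH (average s.y))
          - (Y (average s.x) - β • prob.gradH (Y (average s.x))))
        + β • (average s.w - D) + (Y (average s.x) - Y (average (step prob W α β s).x)) := by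
    rw [A.average_y_step, hD, smul_sub, smul_sub]; abel
  have h5 := norm_add₃_le (a := (average s.y - β • prob.gradH (average s.y))
          - (Y (average s.x) - β • prob.gradH (Y (average s.x)))) (b := β • (average s.w - D))
          (c := Y (average s.x) - Y (average (step prob W α β s).x))
  rw [← h4, norm_smul, Real.norm_of_nonneg hβ] at h5
  have h6 := mul_le_mul_of_nonneg_left
    (h5.trans (add_le_add (add_le_add_left h2 _) h3)) (Real.sqrt_nonneg n)
  have h7 := mul_le_mul_of_nonneg_left h1 hβ
  have h8 := mul_le_mul_of_nonneg_left (A.norm_average_x_move_le (β := β) hs hα)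
    (div_pos hσ hμ).le
  have h9 : (s.errors xs Y).dual = √n * ‖average s.y - Y (average s.x)‖ := rfl
  have h10 : ((step prob W α β s).errors xs Y).dual
      = √n * ‖average (step prob W α β s).y - Y (average (step prob W α β s).x)‖ := rfl
  rw [h9, h10]
  linarith

lemma x_step_le (A : Setting prob W L μ σm σM Y xs) (s : State n px py) (hα : 0 ≤ α) :
    ((step prob W α β s).errors xs Y).x
      ≤ lam W * ((s.errors xs Y).x + α * (s.errors xs Y).q) := by
  refine (stackNorm_dev_mix_le A.stochastic _).trans (mul_le_mul_of_nonneg_left ?_ (lam_nonneg W))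
  have : dev (fun r => s.x r - α • s.q r) = fun r => dev s.x r - α • dev s.q r := by
    funext i; simp only [dev, average_sub, average_smul, smul_sub]; abel
  rw [this]
  refine (stackNorm_sub_le _ _).trans (le_of_eq ?_)
  rw [stackNorm_smul hα]; rfl

lemma y_step_le (A : Setting prob W L μ σm σM Y xs) (s : State n px py) (hβ : 0 ≤ β) :
    ((step prob W α β s).errors xs Y).y
      ≤ lam W * ((s.errors xs Y).y + β * (s.errors xs Y).w) := by
  refine (stackNorm_dev_mix_le A.stochastic _).trans (mul_le_mul_of_nonneg_left ?_ (lam_nonneg W))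
  have : dev (fun r => s.y r + β • s.w r) = fun r => dev s.y r + β • dev s.w r := by
    funext i; simp only [dev, average_add, average_smul, smul_sub]; abel
  rw [this]
  refine (stackNorm_add_le _ _).trans (le_of_eq ?_)
  rw [stackNorm_smul hβ]; rfl

lemma stackNorm_x_move_le (A : Setting prob W L μ σm σM Y xs) {s : State n px py}
    (hs : s.Tracks prob) (hα : 0 ≤ α) :
    stackNorm (fun i => (step prob W α β s).x i - s.x i)
      ≤ (s.errors xs Y).moveX L σM (L + σM ^ 2 / μ) α (s.disagreement prob) := by
  have h1 := stackNorm_move_le s.x (step prob W α β s).x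
  have h2 := A.x_step_le (β := β) s hα
  have h3 := A.norm_average_x_move_le (β := β) hs hα
  have he := s.errors_nonneg xs Y
  have h4 : lam W * ((s.errors xs Y).x + α * (s.errors xs Y).q)
      ≤ 1 * ((s.errors xs Y).x + α * (s.errors xs Y).q) :=
    mul_le_mul_of_nonneg_right A.lam_lt.le (add_nonneg he.x (mul_nonneg hα he.q))
  have h5 : (s.errors xs Y).x = stackNorm (dev s.x) := rfl
  have h6 : ((step prob W α β s).errors xs Y).x = stackNorm (dev (step prob W α β s).x) := rfl
  rw [Errors.moveX]
  linarith

lemma stackNorm_y_move_le (A : Setting prob W L μ σm σM Y xs) {s : State n px py}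
    (hs : s.Tracks prob) (hβ : 0 ≤ β) :
    stackNorm (fun i => (step prob W α β s).y i - s.y i)
      ≤ (s.errors xs Y).moveY L β (s.disagreement prob) := by
  have h1 := stackNorm_move_le s.y (step prob W α β s).y
  have h2 := A.y_step_le (α := α) s hβ
  have h3 := mul_le_mul_of_nonneg_left (A.norm_average_w_le hs) hβ
  rw [A.average_y_step, add_sub_cancel_left, norm_smul, Real.norm_of_nonneg hβ,
    mul_left_comm] at h1
  have he := s.errors_nonneg xs Y
  have h4 : lam W * ((s.errors xs Y).y + β * (s.errors xs Y).w)
      ≤ 1 * ((s.errors xs Y).y + β * (s.errors xs Y).w) :=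
    mul_le_mul_of_nonneg_right A.lam_lt.le (add_nonneg he.y (mul_nonneg hβ he.w))
  have h5 : (s.errors xs Y).y = stackNorm (dev s.y) := rfl
  have h6 : ((step prob W α β s).errors xs Y).y = stackNorm (dev (step prob W α β s).y) := rfl
  rw [Errors.moveY]
  linarith

lemma stackNorm_gradX_sub_le (A : Setting prob W L μ σm σM Y xs) (s s' : State n px py) :
    stackNorm (fun i => gradX prob s'.P s'.x s'.y i - gradX prob s.P s.x s.y i)
      ≤ L * stackNorm (fun i => s'.x i - s.x i) + σM * stackNorm (fun i => s'.y i - s.y i)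
        + (s.disagreement prob + s'.disagreement prob) := by
  have h1 : (fun i => gradX prob s'.P s'.x s'.y i - gradX prob s.P s.x s.y i)
      = fun i => ((gradient (prob.g i) (s'.x i) - gradient (prob.g i) (s.x i))
        + Matrix.toEuclideanLin prob.Pbar.conjTranspose (s'.y i - s.y i))
        + (s'.couplingX prob i - s.couplingX prob i) := by
    funext i
    rw [gradX_eq (fun i => (A.smooth_g i).1), gradX_eq (fun i => (A.smooth_g i).1), map_sub]
    abel
  rw [h1]
  refine (stackNorm_add_le _ _).trans ?_
  have h2 := stackNorm_add_le (fun i => gradient (prob.g i) (s'.x i) - gradient (prob.g i) (s.x i))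
    (fun i => Matrix.toEuclideanLin prob.Pbar.conjTranspose (s'.y i - s.y i))
  have h3 := stackNorm_sub_le (s'.couplingX prob) (s.couplingX prob)
  have h4 := stackNorm_le_of_norm_le A.L_pos.le fun i => (A.smooth_g i).2 (s'.x i) (s.x i)
  have h5 := stackNorm_le_of_norm_le A.sigmaMax_pos.le fun i =>
    A.ops.norm_conjTranspose_le (s'.y i - s.y i)
  have h6 := stackNorm_nonneg (s.couplingY prob)
  have h7 := stackNorm_nonneg (s'.couplingY prob)
  simp only [State.disagreement]
  linarith

lemma stackNorm_gradY_sub_le (A : Setting prob W L μ σm σM Y xs) (s s' : State n px py) :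
    stackNorm (fun i => gradY prob s'.P s'.x s'.y i - gradY prob s.P s.x s.y i)
      ≤ σM * stackNorm (fun i => s'.x i - s.x i) + L * stackNorm (fun i => s'.y i - s.y i)
        + (s.disagreement prob + s'.disagreement prob) := by
  have h1 : (fun i => gradY prob s'.P s'.x s'.y i - gradY prob s.P s.x s.y i)
      = fun i => (Matrix.toEuclideanLin prob.Pbar (s'.x i - s.x i)
        - (gradient (prob.h i) (s'.y i) - gradient (prob.h i) (s.y i)))
        + (s'.couplingY prob i - s.couplingY prob i) := by
    funext i
    rw [gradY_eq (fun i => (A.smooth_h i).1), gradY_eq (fun i => (A.smooth_h i).1), map_sub]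
    abel
  rw [h1]
  refine (stackNorm_add_le _ _).trans ?_
  have h2 := stackNorm_sub_le (fun i => Matrix.toEuclideanLin prob.Pbar (s'.x i - s.x i))
    (fun i => gradient (prob.h i) (s'.y i) - gradient (prob.h i) (s.y i))
  have h3 := stackNorm_sub_le (s'.couplingY prob) (s.couplingY prob)
  have h4 := stackNorm_le_of_norm_le A.L_pos.le fun i => (A.smooth_h i).2 (s'.y i) (s.y i)
  have h5 := stackNorm_le_of_norm_le A.sigmaMax_pos.le fun i => A.ops.norm_le (s'.x i - s.x i)
  have h6 := stackNorm_nonneg (s.couplingX prob)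
  have h7 := stackNorm_nonneg (s'.couplingX prob)
  simp only [State.disagreement]
  linarith

/-- The errors of consecutive states satisfy the scalar recursion. -/
lemma recursion (A : Setting prob W L μ σm σM Y xs) {s : State n px py} (hs : s.Tracks prob)
    (hα : 0 ≤ α) (hαK : α * (L + σM ^ 2 / μ) ^ 2 ≤ μ * σm ^ 2 / L ^ 2 / 2)
    (hβ : 0 ≤ β) (hβL : β * L ^ 2 ≤ μ / 2) :
    Errors.Recursion L μ σM (μ * σm ^ 2 / L ^ 2) (L + σM ^ 2 / μ) α β (lam W)
      (s.disagreement prob + (step prob W α β s).disagreement prob)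
      (s.errors xs Y) ((step prob W α β s).errors xs Y) := by
  have hδ' := (step prob W α β s).disagreement_nonneg (prob := prob)
  have hL := A.L_pos
  have hσ := A.sigmaMax_pos
  have hμ := A.ops.mu_pos
  have hdrift : (s.errors xs Y).drift L σM (L + σM ^ 2 / μ) (s.disagreement prob)
      ≤ (s.errors xs Y).drift L σM (L + σM ^ 2 / μ)
        (s.disagreement prob + (step prob W α β s).disagreement prob) := by
    unfold Errors.drift; linarith
  have hX : stackNorm (fun i => (step prob W α β s).x i - s.x i)
      ≤ (s.errors xs Y).moveX L σM (L + σM ^ 2 / μ) α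
        (s.disagreement prob + (step prob W α β s).disagreement prob) := by
    refine (A.stackNorm_x_move_le hs hα).trans ?_
    unfold Errors.moveX
    gcongr
  have hY : stackNorm (fun i => (step prob W α β s).y i - s.y i)
      ≤ (s.errors xs Y).moveY L β
        (s.disagreement prob + (step prob W α β s).disagreement prob) := by
    refine (A.stackNorm_y_move_le hs hβ).trans ?_
    unfold Errors.moveY
    gcongr
    linarith
  refine ⟨?_, ?_, A.x_step_le s hα, A.y_step_le s hβ, ?_, ?_⟩
  · refine (A.opt_step_le hs hα hαK).trans ?_
    gcongr
    linarith
  · refine (A.dual_step_le hs hα hβ hβL).trans ?_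
    gcongr
    linarith
  · refine (stackNorm_dev_track_le A.stochastic _ _ _).trans ?_
    refine mul_le_mul_of_nonneg_left ?_ (lam_nonneg W)
    have h1 := A.stackNorm_gradX_sub_le s (step prob W α β s)
    have h2 := mul_le_mul_of_nonneg_left hX hL.le
    have h3 := mul_le_mul_of_nonneg_left hY hσ.le
    have h4 : (s.errors xs Y).q = stackNorm (dev s.q) := rfl
    rw [h4]
    exact (add_le_add_right h1 _).trans (by linarith)
  · refine (stackNorm_dev_track_le A.stochastic _ _ _).trans ?_
    refine mul_le_mul_of_nonneg_left ?_ (lam_nonneg W)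
    have h1 := A.stackNorm_gradY_sub_le s (step prob W α β s)
    have h2 := mul_le_mul_of_nonneg_left hX hσ.le
    have h3 := mul_le_mul_of_nonneg_left hY hL.le
    have h4 : (s.errors xs Y).w = stackNorm (dev s.w) := rfl
    rw [h4]
    exact (add_le_add_right h1 _).trans (by linarith)

end Setting

end Recursion

end Iteration

/-! ### Consensus on the coupling matrix -/

section Coupling

variable {n px py : ℕ} {prob : Problem n px py} {W : Matrix (Fin n) (Fin n) ℝ} {α β : ℝ}

open scoped Matrix.Norms.L2Operator in
lemma exists_norm_toEuclideanLin_le (px py : ℕ) :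
    ∃ c : ℝ, 0 ≤ c ∧ ∀ (M : Matrix (Fin py) (Fin px) ℝ) (t : ℝ), (∀ a b, |M a b| ≤ t) →
      (∀ x, ‖Matrix.toEuclideanLin M x‖ ≤ c * t * ‖x‖) ∧
      ∀ y, ‖Matrix.toEuclideanLin M.conjTranspose y‖ ≤ c * t * ‖y‖ := by
  refine ⟨∑ a : Fin py, ∑ b : Fin px, ‖(Matrix.single a b 1 : Matrix (Fin py) (Fin px) ℝ)‖,
    by positivity, fun M t ht => ?_⟩
  have hM : ‖M‖ ≤ (∑ a, ∑ b, ‖(Matrix.single a b 1 : Matrix (Fin py) (Fin px) ℝ)‖) * t := by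
    rw [Matrix.matrix_eq_sum_single M, Finset.sum_mul]
    refine (norm_sum_le _ _).trans (Finset.sum_le_sum fun a _ => ?_)
    rw [Finset.sum_mul]
    refine (norm_sum_le _ _).trans (Finset.sum_le_sum fun b _ => ?_)
    have : Matrix.single a b (M a b)
        = M a b • (Matrix.single a b 1 : Matrix (Fin py) (Fin px) ℝ) := by
      rw [Matrix.smul_single, smul_eq_mul, mul_one]
    rw [this, norm_smul, mul_comm, Real.norm_eq_abs]
    gcongr
    exact ht a b
  constructor
  · intro x
    exact (Matrix.l2_opNorm_mulVec M x).trans (by gcongr)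
  · intro y
    refine (Matrix.l2_opNorm_mulVec M.conjTranspose y).trans ?_
    rw [Matrix.l2_opNorm_conjTranspose]
    gcongr

lemma average_iterate_P (hW : W ∈ doublyStochastic ℝ (Fin n)) (x₀ : Fin n → Vec px)
    (y₀ : Fin n → Vec py) (k : ℕ) : average (iterate prob W α β x₀ y₀ k).P = prob.Pbar := by
  induction k with
  | zero => rfl
  | succ k ih =>
    rw [iterate, Function.iterate_succ_apply']
    simp only [step]
    rw [average_mix hW]
    exact ih

/-- The nodes' coupling matrices converge to their average at the rate `λ`. -/
lemma exists_coupling_le (hW : W ∈ doublyStochastic ℝ (Fin n)) (x₀ : Fin n → Vec px)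
    (y₀ : Fin n → Vec py) : ∃ T : ℝ, 0 ≤ T ∧ ∀ k i,
      (∀ x, ‖Matrix.toEuclideanLin ((iterate prob W α β x₀ y₀ k).P i - prob.Pbar) x‖
        ≤ T * lam W ^ k * ‖x‖) ∧
      ∀ y, ‖Matrix.toEuclideanLin ((iterate prob W α β x₀ y₀ k).P i - prob.Pbar).conjTranspose y‖
        ≤ T * lam W ^ k * ‖y‖ := by
  obtain ⟨c, hc, h⟩ := exists_norm_toEuclideanLin_le px py
  have hentry : ∀ a b k, stackNorm (dev fun i => (iterate prob W α β x₀ y₀ k).P i a b)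
      ≤ lam W ^ k * stackNorm (dev fun i => prob.P i a b) := by
    intro a b k
    induction k with
    | zero => rw [pow_zero, one_mul]; rfl
    | succ k ih =>
      have hmix : (fun i => (iterate prob W α β x₀ y₀ (k + 1)).P i a b)
          = mix W fun i => (iterate prob W α β x₀ y₀ k).P i a b := by
        funext i
        rw [iterate, Function.iterate_succ_apply']
        exact map_mix (Matrix.entryLinearMap ℝ ℝ a b) _ i
      rw [hmix, pow_succ', mul_assoc]
      exact (stackNorm_dev_mix_le hW _).trans (mul_le_mul_of_nonneg_left ih (lam_nonneg W))
  set t := ∑ a, ∑ b, stackNorm (dev fun i => prob.P i a b) with ht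
  have ht0 : ∀ a b, stackNorm (dev fun i => prob.P i a b) ≤ t := by
    intro a b
    refine (Finset.single_le_sum (f := fun b => stackNorm (dev fun i => prob.P i a b))
      (fun b _ => stackNorm_nonneg _) (Finset.mem_univ b)).trans ?_
    exact Finset.single_le_sum (f := fun a => ∑ b, stackNorm (dev fun i => prob.P i a b))
      (fun a _ => Finset.sum_nonneg fun b _ => stackNorm_nonneg _) (Finset.mem_univ a)
  have htn : 0 ≤ t :=
    Finset.sum_nonneg fun a _ => Finset.sum_nonneg fun b _ => stackNorm_nonneg _
  refine ⟨c * t, mul_nonneg hc htn, fun k i => ?_⟩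
  have := h ((iterate prob W α β x₀ y₀ k).P i - prob.Pbar) (t * lam W ^ k) fun a b => by
    have h1 : ((iterate prob W α β x₀ y₀ k).P i - prob.Pbar) a b
        = dev (fun i => (iterate prob W α β x₀ y₀ k).P i a b) i := by
      rw [← average_iterate_P (α := α) (β := β) hW x₀ y₀ k, Matrix.sub_apply, dev]
      congr 1
      exact map_average (Matrix.entryLinearMap ℝ ℝ a b) _
    rw [h1, ← Real.norm_eq_abs]
    refine (norm_le_stackNorm _ i).trans ((hentry a b k).trans ?_)
    rw [mul_comm]
    exact mul_le_mul_of_nonneg_right (ht0 a b) (pow_nonneg (lam_nonneg W) k)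
  rw [← mul_assoc] at this
  exact this

lemma stackNorm_le_stackedDist_add {p : ℕ} (v : Fin n → Vec p) (z : Vec p) :
    stackNorm v ≤ stackedDist v z + √n * ‖z‖ := by
  rw [← stackNorm_const]
  have := stackNorm_add_le (fun i => v i - z) (fun _ => z)
  simp only [sub_add_cancel] at this
  exact this

lemma stackedDist_le {p : ℕ} (v : Fin n → Vec p) (z : Vec p) :
    stackedDist v z ≤ stackNorm (dev v) + √n * ‖average v - z‖ := by
  rw [← stackNorm_const]
  have := stackNorm_add_le (dev v) (fun _ => average v - z)
  simp only [dev, sub_add_sub_cancel] at this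
  exact this

lemma exists_disagreement_le (hW : W ∈ doublyStochastic ℝ (Fin n)) (x₀ : Fin n → Vec px)
    (y₀ : Fin n → Vec py) (xs : Vec px) (ys : Vec py) : ∃ T : ℝ, 0 ≤ T ∧ ∀ k,
      (iterate prob W α β x₀ y₀ k).disagreement prob
        ≤ T * lam W ^ k * (1 + (iterate prob W α β x₀ y₀ k).error xs ys) := by
  obtain ⟨T, hT, h⟩ := exists_coupling_le (prob := prob) (α := α) (β := β) hW x₀ y₀
  obtain ⟨c, hc⟩ : ∃ c, c = √n * ‖xs‖ + √n * ‖ys‖ := ⟨_, rfl⟩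
  have hc0 : 0 ≤ c := by rw [hc]; positivity
  refine ⟨T * (1 + c), by positivity, fun k => ?_⟩
  set s := iterate prob W α β x₀ y₀ k
  have hTk : 0 ≤ T * lam W ^ k := mul_nonneg hT (pow_nonneg (lam_nonneg W) k)
  have h1 : stackNorm (s.couplingX prob) ≤ T * lam W ^ k * stackNorm s.y :=
    stackNorm_le_of_norm_le hTk fun i => (h k i).2 _
  have h2 : stackNorm (s.couplingY prob) ≤ T * lam W ^ k * stackNorm s.x :=
    stackNorm_le_of_norm_le hTk fun i => (h k i).1 _
  have h3 := stackNorm_le_stackedDist_add s.x xs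
  have h4 := stackNorm_le_stackedDist_add s.y ys
  have h5 : 0 ≤ s.error xs ys := add_nonneg (Real.sqrt_nonneg _) (Real.sqrt_nonneg _)
  have h6 : s.error xs ys = stackedDist s.x xs + stackedDist s.y ys := rfl
  have h7 : stackNorm s.x + stackNorm s.y ≤ (1 + c) * (1 + s.error xs ys) := by
    have := mul_nonneg hc0 h5
    linarith
  calc s.disagreement prob ≤ T * lam W ^ k * (stackNorm s.x + stackNorm s.y) := by
        rw [State.disagreement]; linarith
    _ ≤ T * lam W ^ k * ((1 + c) * (1 + s.error xs ys)) := by gcongr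
    _ = _ := by ring

end Coupling

/-! ### Linear convergence -/

section Convergence

variable {n px py : ℕ} {prob : Problem n px py} {W : Matrix (Fin n) (Fin n) ℝ} {α β : ℝ}
  {L μ σm σM : ℝ} {Y : Vec px → Vec py} {xs : Vec px}

lemma Setting.error_le (A : Setting prob W L μ σm σM Y xs) (s : State n px py) :
    s.error xs (Y xs) ≤ (1 + σM / μ) * (s.errors xs Y).opt + (s.errors xs Y).dual
      + (s.errors xs Y).x + (s.errors xs Y).y := by
  have h1 := stackedDist_le s.x xs
  have h2 := stackedDist_le s.y (Y xs)
  have h3 := (norm_sub_le_norm_sub_add_norm_sub (average s.y) (Y (average s.x)) (Y xs)).trans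
    (add_le_add_right (A.lipschitz (average s.x) xs) _)
  have h4 := mul_le_mul_of_nonneg_left h3 (Real.sqrt_nonneg n)
  simp only [State.error, State.errors]
  linarith

/-- A Lyapunov function that contracts along the error recursion up to a multiple of the
disagreement yields convergence at every rate above its contraction factor and above `λ`. -/
lemma Setting.exists_error_le (A : Setting prob W L μ σm σM Y xs)
    (hα : 0 ≤ α) (hαK : α * (L + σM ^ 2 / μ) ^ 2 ≤ μ * σm ^ 2 / L ^ 2 / 2)
    (hβ : 0 ≤ β) (hβL : β * L ^ 2 ≤ μ / 2) {w a b z ζ T ρ ρ' : ℝ} (hw : 0 < w) (ha : 0 < a)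
    (hb : 0 < b) (hz : 0 < z) (hζ : 0 < ζ) (hT : 0 ≤ T) (hρ : 0 ≤ ρ) (hρρ : ρ < ρ')
    (hlρ : lam W ≤ ρ')
    (henergy : ∀ (δ : ℝ) (e e' : Errors), 0 ≤ δ → e.Nonneg →
      Errors.Recursion L μ σM (μ * σm ^ 2 / L ^ 2) (L + σM ^ 2 / μ) α β (lam W) δ e e' →
      e'.energy w a b z ζ ≤ ρ * e.energy w a b z ζ + T * δ)
    (x₀ : Fin n → Vec px) (y₀ : Fin n → Vec py) :
    ∃ ψ : ℝ, 0 < ψ ∧ ∀ k, (iterate prob W α β x₀ y₀ k).error xs (Y xs) ≤ ψ * ρ' ^ k := by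
  have hμ := A.ops.mu_pos
  have hσ := A.sigmaMax_pos
  have hl := lam_nonneg W
  obtain ⟨V, hV⟩ : ∃ V : ℕ → ℝ, V = fun k =>
    ((iterate prob W α β x₀ y₀ k).errors xs Y).energy w a b z ζ := ⟨_, rfl⟩
  have hV0 : ∀ k, 0 ≤ V k := by
    intro k
    obtain ⟨ho, hd, hx, hq, hy, hw'⟩ := (iterate prob W α β x₀ y₀ k).errors_nonneg xs Y
    rw [hV]
    simp only [Errors.energy, Errors.fast]
    positivity
  obtain ⟨c, hc⟩ : ∃ c, c = (1 + σM / μ) + 1 / w + 1 / (w * z) + 1 / (w * a) := ⟨_, rfl⟩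
  have hc0 : 0 < c := by rw [hc]; positivity
  have herr : ∀ k, (iterate prob W α β x₀ y₀ k).error xs (Y xs) ≤ c * V k := by
    intro k
    refine (A.error_le _).trans ?_
    have hVk : V k = ((iterate prob W α β x₀ y₀ k).errors xs Y).energy w a b z ζ := by rw [hV]
    obtain ⟨ho, hd, hx, hq, hy, hw'⟩ := (iterate prob W α β x₀ y₀ k).errors_nonneg xs Y
    generalize (iterate prob W α β x₀ y₀ k).errors xs Y = e at *
    rw [Errors.energy, Errors.fast] at hVk
    have p1 := mul_nonneg hw.le hd
    have p2 := mul_nonneg hw.le (mul_nonneg ha.le hy)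
    have p3 := mul_nonneg hw.le (mul_nonneg hb.le hw')
    have p4 := mul_nonneg hw.le (mul_nonneg hz.le hx)
    have p5 := mul_nonneg hw.le (mul_nonneg hζ.le hq)
    have e1 : (1 + σM / μ) * e.opt ≤ (1 + σM / μ) * V k := by gcongr; linarith
    have e2 : e.dual ≤ 1 / w * V k := by
      rw [div_mul_eq_mul_div, one_mul, le_div_iff₀ hw]; linarith
    have e3 : e.x ≤ 1 / (w * z) * V k := by
      rw [div_mul_eq_mul_div, one_mul, le_div_iff₀ (by positivity)]; linarith
    have e4 : e.y ≤ 1 / (w * a) * V k := by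
      rw [div_mul_eq_mul_div, one_mul, le_div_iff₀ (by positivity)]; linarith
    rw [hc]
    linarith
  obtain ⟨T', hT', hdis⟩ := exists_disagreement_le (prob := prob) (α := α) (β := β)
    A.stochastic x₀ y₀ xs (Y xs)
  have hstep : ∀ k, V (k + 1)
      ≤ ρ * V k + T * (2 * T' * (1 + c)) * lam W ^ k * (1 + V k + V (k + 1)) := by
    intro k
    have hrec := A.recursion (tracks_iterate (α := α) (β := β) A.stochastic x₀ y₀ k) hα hαK hβ hβL
    have hsucc : step prob W α β (iterate prob W α β x₀ y₀ k)
        = iterate prob W α β x₀ y₀ (k + 1) := by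
      rw [iterate, iterate, Function.iterate_succ_apply']
    rw [hsucc] at hrec
    have h1 := henergy _ _ _ (add_nonneg (State.disagreement_nonneg _)
      (State.disagreement_nonneg _)) (State.errors_nonneg _ xs Y) hrec
    have hVk : ∀ j, ((iterate prob W α β x₀ y₀ j).errors xs Y).energy w a b z ζ = V j := by
      intro j; rw [hV]
    rw [hVk, hVk] at h1
    have hlk : 0 ≤ lam W ^ k := pow_nonneg hl k
    have hd : ∀ j, k ≤ j → (iterate prob W α β x₀ y₀ j).disagreement prob
        ≤ T' * lam W ^ k * (1 + c * V j) := by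
      intro j hj
      refine (hdis j).trans ?_
      have : 0 ≤ (iterate prob W α β x₀ y₀ j).error xs (Y xs) :=
        add_nonneg (Real.sqrt_nonneg _) (Real.sqrt_nonneg _)
      have h3 := pow_le_pow_of_le_one hl A.lam_lt.le hj
      have h4 := herr j
      gcongr
    have h2 : (iterate prob W α β x₀ y₀ k).disagreement prob
        + (iterate prob W α β x₀ y₀ (k + 1)).disagreement prob
        ≤ 2 * T' * (1 + c) * lam W ^ k * (1 + V k + V (k + 1)) := by
      have h3 := hd k le_rfl
      have h4 := hd (k + 1) (Nat.le_succ k)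
      have h5 : 2 + c * V k + c * V (k + 1) ≤ 2 * (1 + c) * (1 + V k + V (k + 1)) := by
        have := hV0 k
        have := hV0 (k + 1)
        have := mul_nonneg hc0.le (hV0 k)
        have := mul_nonneg hc0.le (hV0 (k + 1))
        linarith
      have h6 := mul_le_mul_of_nonneg_left h5 (mul_nonneg hT' hlk)
      linarith
    have h3 := mul_le_mul_of_nonneg_left h2 hT
    linarith
  obtain ⟨ψ, hψ, h⟩ := geometric_of_perturbed hV0 hρ hρρ hl A.lam_lt hlρ (by positivity) hstep
  refine ⟨c * ψ, mul_pos hc0 hψ, fun k => (herr k).trans ?_⟩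
  rw [mul_assoc]
  exact mul_le_mul_of_nonneg_left (h k) hc0.le

end Convergence

/-! ### The problem data -/

section Data

variable {n px py : ℕ} {prob : Problem n px py} {L₁ L₂ L μ : ℝ}

lemma IsSmooth.mono {p : ℕ} {f : Vec p → ℝ} (h : IsSmooth L₁ f) (hL : L₁ ≤ L) : IsSmooth L f :=
  ⟨h.1, fun x y => (h.2 x y).trans (by gcongr)⟩

lemma norm_average_sub_average_le {p : ℕ} {u v : Fin n → Vec p} {c : ℝ} (hc : 0 ≤ c)
    (h : ∀ i, ‖u i - v i‖ ≤ c) : ‖average u - average v‖ ≤ c := by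
  rcases Nat.eq_zero_or_pos n with rfl | hn
  · simpa [average] using hc
  have hn' : (0 : ℝ) < n := by exact_mod_cast hn
  have h1 : ‖∑ i, (u i - v i)‖ ≤ n * c := by
    simpa using norm_sum_le_of_le Finset.univ fun i _ => h i
  rw [← average_sub, average, norm_smul, Real.norm_of_nonneg (by positivity)]
  calc 1 / (n : ℝ) * ‖∑ i, (u i - v i)‖ ≤ 1 / (n : ℝ) * (n * c) := by gcongr
    _ = c := by field_simp

lemma hasGradientAt_G (hg : ∀ i, IsSmooth L (prob.g i)) (x : Vec px) :
    HasGradientAt prob.G (prob.gradG x) x :=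
  hasGradientAt_average fun i => ((hg i).1 x).hasGradientAt

lemma hasGradientAt_H (hh : ∀ i, IsSmooth L (prob.h i)) (y : Vec py) :
    HasGradientAt prob.H (prob.gradH y) y :=
  hasGradientAt_average fun i => ((hh i).1 y).hasGradientAt

lemma SmoothConvex.monotone_gradH (h : SmoothConvex prob L₁ L₂ μ) (y y' : Vec py) :
    μ * ‖y - y'‖ ^ 2 ≤ inner ℝ (prob.gradH y - prob.gradH y') (y - y') := by
  have h1 := h.stronglyConvex_H.2 y y'
  have h2 := h.stronglyConvex_H.2 y' y
  rw [(hasGradientAt_H h.smooth_h _).gradient] at h1 h2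
  rw [← neg_sub y y', inner_neg_right, norm_neg] at h2
  rw [inner_sub_left]
  linarith

lemma SmoothConvex.monotone_gradG (h : SmoothConvex prob L₁ L₂ μ) (x x' : Vec px) :
    0 ≤ inner ℝ (prob.gradG x - prob.gradG x') (x - x') := by
  have h1 := ConvexOn.add_inner_gradient_le h.convex_G (hasGradientAt_G h.smooth_g x') x
  have h2 := ConvexOn.add_inner_gradient_le h.convex_G (hasGradientAt_G h.smooth_g x) x'
  rw [← neg_sub x x', inner_neg_right] at h2
  rw [inner_sub_left]
  linarith

lemma SmoothConvex.mu_le (h : SmoothConvex prob L₁ L₂ μ) (hL₂ : 0 < L₂) (hpy : 0 < py) :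
    μ ≤ L₂ := by
  obtain ⟨y, hy⟩ : ∃ y : Vec py, ‖y‖ = 1 :=
    ⟨EuclideanSpace.single ⟨0, hpy⟩ 1, by simp⟩
  have h1 := mul_norm_sub_le_of_stronglyMonotone h.monotone_gradH y 0
  have h2 : ‖prob.gradH y - prob.gradH 0‖ ≤ L₂ * ‖y - 0‖ :=
    norm_average_sub_average_le (by positivity) fun i => (h.smooth_h i).2 y 0
  rw [sub_zero, hy] at h1 h2
  linarith

lemma SmoothConvex.saddleOperators (h : SmoothConvex prob L₁ L₂ μ) {σm σM : ℝ} (hL₁ : 0 < L₁)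
    (hL₂ : 0 < L₂) (hμ : 0 < μ) (hσm : 0 < σm) (hpy : 0 < py) (hm : sigmaMin prob.Pbar = σm)
    (hM : sigmaMax prob.Pbar = σM) :
    SaddleOperators prob.gradG prob.gradH prob.Pbar (max L₁ L₂) μ σm σM where
  mu_pos := hμ
  sigmaMin_pos := hσm
  mu_le := (h.mu_le hL₂ hpy).trans (le_max_right _ _)
  sigmaMin_le := by
    rw [← hm, ← hM]
    exact LinearMap.singularValues_antitone _ (Nat.zero_le _)
  lipschitz_G x x' := norm_average_sub_average_le (by positivity) fun i =>
    ((h.smooth_g i).mono (le_max_left _ _)).2 x x'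
  monotone_G := h.monotone_gradG
  lipschitz_H y y' := norm_average_sub_average_le (by positivity) fun i =>
    ((h.smooth_h i).mono (le_max_right _ _)).2 y y'
  monotone_H := h.monotone_gradH
  norm_le x := by
    rw [← hM]
    exact norm_apply_le_singularValues_zero _ x
  le_norm x := by
    rw [← hm]
    exact singularValues_last_mul_norm_le _ finrank_euclideanSpace_fin x

end Data

/-! ### Stepsizes and rates -/

section Rates

/-- What the lower bound on `γ² κ⁴` provides: the spectral gap and the stepsize `β̄` are bounded
below in terms of `L` and `μ` alone. -/
lemma betaBar_bounds {L μ σm σM l : ℝ} (hμ : 0 < μ) (hμL : μ ≤ L) (hσm : 0 < σm) (hσ : σm ≤ σM)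
    (hl0 : 0 ≤ l) (hl1 : l < 1)
    (h₁ : (σM / σm) ^ 6 * (L / μ) ^ 2 / (1 - l) ^ 4 ≤ (σM / σm) ^ 2 * (L / μ) ^ 4)
    (h₂ : σm ^ 2 * σM ^ 2 / (L ^ 2 * μ ^ 2 * (1 - l) ^ 4) ≤ (σM / σm) ^ 2 * (L / μ) ^ 4) :
    l ≤ 1 - μ / L ∧ μ ^ 2 / (382 * L ^ 3) ≤ betaBar L μ σm σM l ∧
      betaBar L μ σm σM l * L ≤ (1 - l) ^ 2 / 192 ∧
      betaBar L μ σm σM l * L ≤ μ / (382 * L) := by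
  have hL : 0 < L := hμ.trans_le hμL
  have hσM : 0 < σM := hσm.trans_le hσ
  obtain ⟨s, hs⟩ : ∃ s, s = 1 - l := ⟨_, rfl⟩
  have hs0 : 0 < s := by linarith
  have hs1 : s ≤ 1 := by linarith
  rw [← hs] at h₁ h₂
  have k1 : σM ^ 2 * μ ≤ L * s ^ 2 * σm ^ 2 := by
    refine le_of_sq_le_sq ?_ (by positivity)
    have h := mul_le_mul_of_nonneg_left h₁
      (show 0 ≤ σm ^ 6 * μ ^ 4 * s ^ 4 / (σM ^ 2 * L ^ 2) by positivity)
    have e1 : σm ^ 6 * μ ^ 4 * s ^ 4 / (σM ^ 2 * L ^ 2) * ((σM / σm) ^ 6 * (L / μ) ^ 2 / s ^ 4)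
        = (σM ^ 2 * μ) ^ 2 := by field_simp
    have e2 : σm ^ 6 * μ ^ 4 * s ^ 4 / (σM ^ 2 * L ^ 2) * ((σM / σm) ^ 2 * (L / μ) ^ 4)
        = (L * s ^ 2 * σm ^ 2) ^ 2 := by field_simp
    rwa [e1, e2] at h
  have k2 : σm ^ 2 * μ ≤ L ^ 3 * s ^ 2 := by
    refine le_of_sq_le_sq ?_ (by positivity)
    have h := mul_le_mul_of_nonneg_left h₂
      (show 0 ≤ σm ^ 2 * μ ^ 4 * L ^ 2 * s ^ 4 / σM ^ 2 by positivity)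
    have e1 : σm ^ 2 * μ ^ 4 * L ^ 2 * s ^ 4 / σM ^ 2
        * (σm ^ 2 * σM ^ 2 / (L ^ 2 * μ ^ 2 * s ^ 4)) = (σm ^ 2 * μ) ^ 2 := by field_simp
    have e2 : σm ^ 2 * μ ^ 4 * L ^ 2 * s ^ 4 / σM ^ 2 * ((σM / σm) ^ 2 * (L / μ) ^ 4)
        = (L ^ 3 * s ^ 2) ^ 2 := by field_simp
    rwa [e1, e2] at h
  have k3 : μ ≤ L * s ^ 2 := by
    have : μ * σm ^ 2 ≤ L * s ^ 2 * σm ^ 2 := by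
      refine le_trans ?_ k1
      rw [mul_comm]
      gcongr
    exact le_of_mul_le_mul_right this (by positivity)
  have hss : s ^ 2 ≤ s := by rw [pow_two]; exact mul_le_of_le_one_left hs0.le hs1
  have b1 : betaBar L μ σm σM l ≤ σm ^ 2 * s ^ 2 / (192 * σM ^ 2 * L) := by
    rw [hs]; exact min_le_left _ _
  have b2 : betaBar L μ σm σM l ≤ 1 / (382 * (L / μ) * L) :=
    (min_le_right _ _).trans (min_le_right _ _)
  refine ⟨?_, ?_, ?_, ?_⟩
  · have : μ / L ≤ s := by
      rw [div_le_iff₀ hL]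
      calc μ ≤ L * s ^ 2 := k3
        _ ≤ L * s := by gcongr
        _ = s * L := mul_comm _ _
    linarith
  · rw [betaBar, ← hs]
    refine le_min ?_ (le_min ?_ ?_)
    · calc μ ^ 2 / (382 * L ^ 3) ≤ μ * L / (192 * L ^ 3) := by
            rw [pow_two]; gcongr; norm_num
        _ = σM ^ 2 * μ / (192 * σM ^ 2 * L * L) := by field_simp
        _ ≤ L * s ^ 2 * σm ^ 2 / (192 * σM ^ 2 * L * L) := by gcongr
        _ = _ := by field_simp
    · have k4 : σM ^ 2 * μ ^ 2 ≤ L ^ 4 * s ^ 2 := by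
        calc σM ^ 2 * μ ^ 2 = σM ^ 2 * μ * μ := by ring
          _ ≤ L * s ^ 2 * σm ^ 2 * μ := by gcongr
          _ = L * s ^ 2 * (σm ^ 2 * μ) := by ring
          _ ≤ L * s ^ 2 * (L ^ 3 * s ^ 2) := by gcongr
          _ = L ^ 4 * s ^ 2 * s ^ 2 := by ring
          _ ≤ L ^ 4 * s ^ 2 * 1 := by gcongr; linarith
          _ = _ := mul_one _
      calc μ ^ 2 / (382 * L ^ 3) = σM ^ 2 * μ ^ 2 / (382 * L ^ 3 * σM ^ 2) := by field_simp
        _ ≤ L ^ 4 * s ^ 2 / (48 * L ^ 3 * σM ^ 2) := by gcongr; norm_num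
        _ = _ := by field_simp
    · calc μ ^ 2 / (382 * L ^ 3) ≤ μ * L / (382 * L ^ 3) := by rw [pow_two]; gcongr
        _ = _ := by field_simp
  · calc betaBar L μ σm σM l * L ≤ σm ^ 2 * s ^ 2 / (192 * σM ^ 2 * L) * L := by gcongr
      _ = σm ^ 2 * s ^ 2 / (192 * σM ^ 2) := by field_simp
      _ ≤ σM ^ 2 * s ^ 2 / (192 * σM ^ 2) := by gcongr
      _ = s ^ 2 / 192 := by field_simp
      _ = _ := by rw [hs]
  · calc betaBar L μ σm σM l * L ≤ 1 / (382 * (L / μ) * L) * L := by gcongr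
      _ = _ := by field_simp

/-- Linear convergence at the rate `1 - 1/(M/2)` gives `ε`-accuracy after `M log (1/ε)` iterations:
the factor `1/2` turns `ε` into `ε²`, which absorbs the constant for small `ε`. -/
lemma complexity_of_linear {e : ℕ → ℝ} {ψ M : ℝ} (hψ : 0 < ψ) (hM : 2 ≤ M)
    (h : ∀ k, e k ≤ ψ * (1 - 1 / (M / 2)) ^ k) :
    ∃ ε₀ : ℝ, 0 < ε₀ ∧ ∀ ε : ℝ, 0 < ε → ε ≤ ε₀ → ∀ k : ℕ,
      M * Real.log (1 / ε) ≤ k → e k ≤ ε := by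
  refine ⟨1 / ψ, by positivity, fun ε hε hε₀ k hk => (h k).trans ?_⟩
  have hM0 : 0 < M := by linarith
  have h0 : 0 ≤ 1 - 1 / (M / 2) := by
    have : 1 / (M / 2) ≤ 1 := by rw [div_le_one (by positivity)]; linarith
    linarith
  have h1 : (1 - 1 / (M / 2)) ^ k ≤ ε ^ 2 := by
    calc (1 - 1 / (M / 2)) ^ k ≤ Real.exp (-(1 / (M / 2))) ^ k := by
          gcongr
          have := Real.add_one_le_exp (-(1 / (M / 2)))
          linarith
      _ = Real.exp (-(2 * (k / M))) := by
          rw [← Real.exp_nat_mul]; congr 1; field_simp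
      _ ≤ Real.exp (2 * Real.log ε) := by
          have : -Real.log ε ≤ k / M := by
            rw [le_div_iff₀ hM0]
            rw [one_div, Real.log_inv] at hk
            linarith
          gcongr
          linarith
      _ = ε ^ 2 := by
          rw [two_mul, Real.exp_add, Real.exp_log hε, pow_two]
  rw [le_div_iff₀ hψ] at hε₀
  calc ψ * (1 - 1 / (M / 2)) ^ k ≤ ψ * ε ^ 2 := by gcongr
    _ = ε * ψ * ε := by ring
    _ ≤ 1 * ε := by gcongr
    _ = ε := one_mul ε

end Rates

/-! ### The saddle point and the convergence rate -/

section Rate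

variable {n px py : ℕ} {prob : Problem n px py} {W : Matrix (Fin n) (Fin n) ℝ}
  {L₁ L₂ μ σm σM : ℝ}

lemma SmoothConvex.exists_setting (h : SmoothConvex prob L₁ L₂ μ) (hL₁ : 0 < L₁) (hL₂ : 0 < L₂)
    (hμ : 0 < μ) (hσm : 0 < σm) (hpy : 0 < py) (hm : sigmaMin prob.Pbar = σm)
    (hM : sigmaMax prob.Pbar = σM) (hW : W ∈ doublyStochastic ℝ (Fin n)) (hlam : lam W < 1) :
    ∃ Y xs, Setting prob W (max L₁ L₂) μ σm σM Y xs := by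
  have S := h.saddleOperators hL₁ hL₂ hμ hσm hpy hm hM
  obtain ⟨Y, hY, hYL⟩ := S.exists_maximizer
  obtain ⟨xs, hxs⟩ := S.exists_primal_eq_zero hY hYL
  exact ⟨Y, xs, S, fun i => (h.smooth_g i).mono (le_max_left _ _),
    fun i => (h.smooth_h i).mono (le_max_right _ _), hW, hlam, hY, hYL, hxs⟩

lemma SmoothConvex.isSaddle_iff (h : SmoothConvex prob L₁ L₂ μ) (hμ : 0 < μ) (x : Vec px)
    (y : Vec py) : prob.IsSaddle x y ↔
      prob.gradG x + Matrix.toEuclideanLin prob.Pbar.conjTranspose y = 0 ∧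
        prob.gradH y = Matrix.toEuclideanLin prob.Pbar x := by
  refine Problem.isSaddle_iff (hasGradientAt_G h.smooth_g) (hasGradientAt_H h.smooth_h)
    (fun x x' => ConvexOn.add_inner_gradient_le h.convex_G (hasGradientAt_G h.smooth_g x) x')
    (fun y y' => ?_) x y
  have h1 := h.stronglyConvex_H.2 y' y
  rw [(hasGradientAt_H h.smooth_h _).gradient] at h1
  have : 0 ≤ μ / 2 * ‖y' - y‖ ^ 2 := by positivity
  linarith

lemma Setting.existsUnique_saddle {L : ℝ} {Y : Vec px → Vec py} {xs : Vec px}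
    (A : Setting prob W L μ σm σM Y xs) (h : SmoothConvex prob L₁ L₂ μ) :
    prob.IsSaddle xs (Y xs) ∧ ∀ x y, prob.IsSaddle x y → x = xs ∧ y = Y xs := by
  have hsaddle := h.isSaddle_iff A.ops.mu_pos
  refine ⟨(hsaddle _ _).2 ⟨A.stationary, A.maximizer xs⟩, fun x y hxy => ?_⟩
  obtain ⟨h1, h2⟩ := (hsaddle x y).1 hxy
  exact A.ops.eq_and_eq_of_stationary h1 h2 A.stationary (A.maximizer xs)

/-- The rate of the Lyapunov function, for the stepsizes `ᾱ` and `β̄`, in terms of `γ` and `κ`. -/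
lemma rate_bound {L c l : ℝ} (hμ : 0 < μ) (hμL : μ ≤ L) (hσm : 0 < σm) (hσM : 0 < σM) (hc : 0 < c)
    (hβ : μ ^ 2 / (382 * L ^ 3) ≤ betaBar L μ σm σM l) :
    1 / (764 * (c * ((σM / σm) ^ 2 * (L / μ) ^ 5)))
      ≤ alphaBar c L μ σm σM l * (μ * σm ^ 2 / L ^ 2) / 2 := by
  have hL : 0 < L := hμ.trans_le hμL
  calc 1 / (764 * (c * ((σM / σm) ^ 2 * (L / μ) ^ 5)))
      = μ ^ 2 / (382 * L ^ 3) * (μ ^ 2 / (c * σM ^ 2)) * (μ * σm ^ 2 / L ^ 2) / 2 := by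
        field_simp; norm_num
    _ ≤ _ := by rw [alphaBar]; gcongr

end Rate

end GTGDA

end

theorem corollary1 :
    -- an absolute constant
    ∃ C : ℝ, 0 < C ∧
    ∀ L₁ L₂ μ σm σM : ℝ, 0 < L₁ → 0 < L₂ → 0 < μ → 0 < σm → 0 < σM →
    -- how large `c` has to be depends only on `L₁, L₂, μ, σm, σM`, not on the network
    ∃ c₀ : ℝ, 0 < c₀ ∧ ∀ c : ℝ, c₀ ≤ c →
    ∀ (n px py : ℕ), 1 ≤ n → 1 ≤ px →
    ∀ (prob : GTGDA.Problem n px py) (W : Matrix (Fin n) (Fin n) ℝ),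
    GTGDA.SmoothConvex prob L₁ L₂ μ →
    prob.Pbar.rank = px →
    GTGDA.sigmaMin prob.Pbar = σm → GTGDA.sigmaMax prob.Pbar = σM →
    W.IsPrimitive → W ∈ doublyStochastic ℝ (Fin n) → GTGDA.lam W < 1 →
    ∀ L κ γ l α β : ℝ, L = max L₁ L₂ → κ = L / μ → γ = σM / σm → l = GTGDA.lam W →
    α = GTGDA.alphaBar c L μ σm σM l → β = GTGDA.betaBar L μ σm σM l →
    γ ^ 2 * κ ^ 4 ≥ max (γ ^ 6 * κ ^ 2 / (1 - l) ^ 4)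
      (σm ^ 2 * σM ^ 2 / (L ^ 2 * μ ^ 2 * (1 - l) ^ 4)) →
    ∃ (xs : GTGDA.Vec px) (ys : GTGDA.Vec py),
      prob.IsSaddle xs ys ∧ (∀ x y, prob.IsSaddle x y → x = xs ∧ y = ys) ∧
      ∀ (x₀ : Fin n → GTGDA.Vec px) (y₀ : Fin n → GTGDA.Vec py),
        -- linear convergence
        (∃ ψ : ℝ, 0 < ψ ∧ ∀ k : ℕ,
          (GTGDA.iterate prob W α β x₀ y₀ k).error xs ys
            ≤ ψ * (1 - 1 / (C * c * (γ ^ 2 * κ ^ 5))) ^ k) ∧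
        -- the complexity of an `ε`-optimal solution
        (∃ ε₀ : ℝ, 0 < ε₀ ∧ ∀ ε : ℝ, 0 < ε → ε ≤ ε₀ → ∀ k : ℕ,
          C * c * (γ ^ 2 * κ ^ 5) * Real.log (1 / ε) ≤ k →
          (GTGDA.iterate prob W α β x₀ y₀ k).error xs ys ≤ ε) := by
  refine ⟨4000, by norm_num, fun L₁ L₂ μ σm σM hL₁ hL₂ hμ hσm hσM => ?_⟩
  by_cases hμL : μ ≤ max L₁ L₂
  swap
  -- `H` cannot be more convex than it is smooth, so this case does not occur
  · refine ⟨1, one_pos, ?_⟩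
    intro c _ n px py _ hpx prob W hprob hrank
    have hpy : 0 < py := by
      have := prob.Pbar.rank_le_height
      omega
    exact absurd ((hprob.mu_le hL₂ hpy).trans (le_max_right _ _)) hμL
  obtain ⟨L, hL⟩ : ∃ L, L = max L₁ L₂ := ⟨_, rfl⟩
  rw [← hL] at hμL
  have hL0 : 0 < L := hμ.trans_le hμL
  obtain ⟨m, hm⟩ : ∃ m, m = μ * σm ^ 2 / L ^ 2 := ⟨_, rfl⟩
  obtain ⟨K, hK⟩ : ∃ K, K = L + σM ^ 2 / μ := ⟨_, rfl⟩
  have hm0 : 0 < m := by rw [hm]; positivity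
  have hK0 : 0 < K := by rw [hK]; positivity
  obtain ⟨α₀, hα₀, henergy⟩ := GTGDA.Errors.exists_energy_le hμ hμL hσM hm0 hK0
  obtain ⟨α₁, hα₁⟩ : ∃ α₁, α₁ = min α₀ (m / 2 / K ^ 2) := ⟨_, rfl⟩
  have hα₁0 : 0 < α₁ := by rw [hα₁]; positivity
  -- `β̄ ≤ μ / (382 L²)`, so this makes `ᾱ ≤ α₁`
  refine ⟨max 1 (μ / (382 * L ^ 2) * (μ ^ 2 / σM ^ 2) / α₁), by positivity, ?_⟩
  intro c hc n px py _ hpx prob W hprob hrank hsm hsM _ hW hlam L' κ γ l α β hL' hκ hγ hl hα hβ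
    hcond
  have hLL : L' = L := by rw [hL', hL]
  subst hLL
  have hpy : 0 < py := by
    have := prob.Pbar.rank_le_height
    omega
  have hc1 : 1 ≤ c := (le_max_left _ _).trans hc
  have hc0 : 0 < c := by linarith
  obtain ⟨Y, xs, A⟩ := hprob.exists_setting hL₁ hL₂ hμ hσm hpy hsm hsM hW hlam
  rw [← hL] at A
  have hσ := A.ops.sigmaMin_le
  have hl0 : 0 ≤ l := by rw [hl]; exact GTGDA.lam_nonneg W
  have hl1 : l < 1 := by rw [hl]; exact hlam
  obtain ⟨hgap, hβ1, hβ2, hβ3⟩ := GTGDA.betaBar_bounds hμ hμL hσm hσ hl0 hl1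
    (by rw [← hγ, ← hκ]; exact (le_max_left _ _).trans hcond)
    (by rw [← hγ, ← hκ]; exact (le_max_right _ _).trans hcond)
  have hrate := GTGDA.rate_bound hμ hμL hσm hσM hc0 hβ1
  rw [← hα, ← hm, ← hγ, ← hκ] at hrate
  rw [← hβ] at hβ1 hβ2 hβ3
  have hβ0 : 0 < β := lt_of_lt_of_le (by positivity) hβ1
  have hαβ : α = β * (μ ^ 2 / (c * σM ^ 2)) := by rw [hα, hβ]; rfl
  have hα0 : 0 < α := by rw [hαβ]; positivity
  have hβ4 : β ≤ μ / (382 * L' ^ 2) := by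
    rw [le_div_iff₀ (by positivity)] at hβ3 ⊢
    linarith
  have hαα₁ : α ≤ α₁ := by
    have h1 := (le_max_right _ _).trans hc
    rw [div_le_iff₀ hα₁0] at h1
    calc α ≤ μ / (382 * L' ^ 2) * (μ ^ 2 / (c * σM ^ 2)) := by rw [hαβ]; gcongr
      _ = μ / (382 * L' ^ 2) * (μ ^ 2 / σM ^ 2) / c := by field_simp
      _ ≤ c * α₁ / c := by gcongr
      _ = α₁ := by field_simp
  have hαK : α * K ^ 2 ≤ m / 2 := by
    rw [← le_div_iff₀ (by positivity)]
    exact hαα₁.trans (hα₁ ▸ min_le_right _ _)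
  have hβL : β * L' ^ 2 ≤ μ / 2 := by
    rw [le_div_iff₀ (by positivity)] at hβ4
    have : 0 < β * L' ^ 2 := by positivity
    linarith
  obtain ⟨w, a, b, z, ζ, T, hw, ha, hb, hz, hζ, hT, hV⟩ := henergy α β l hα0
    (hαα₁.trans (hα₁ ▸ min_le_left _ _)) hl0 hgap hβ1 hβ2 hβ3
  -- the claimed rate lies strictly above the rate of the Lyapunov function and above `λ`
  have hκ1 : 1 ≤ κ := by rw [hκ, le_div_iff₀ hμ]; linarith
  have hγ1 : 1 ≤ γ := by rw [hγ, le_div_iff₀ hσm]; linarith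
  obtain ⟨D, hD⟩ : ∃ D, D = c * (γ ^ 2 * κ ^ 5) := ⟨_, rfl⟩
  have hκD : κ ≤ D := by
    have h1 : 1 ≤ γ ^ 2 := one_le_pow₀ hγ1
    have h2 : κ ≤ κ ^ 5 := le_self_pow₀ hκ1 (by norm_num)
    calc κ = 1 * (1 * κ) := by ring
      _ ≤ c * (γ ^ 2 * κ ^ 5) := by gcongr
      _ = D := hD.symm
  have hD1 : 1 ≤ D := hκ1.trans hκD
  have hD0 : 0 < D := by linarith
  have hmain : 4000 * c * (γ ^ 2 * κ ^ 5) = 4000 * D := by rw [hD]; ring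
  rw [hmain]
  rw [← hD] at hrate
  have hρ0 : 0 ≤ 1 - α * m / 2 := by
    have hmK : m ≤ K := by rw [hm, hK]; exact A.ops.primal_const_le
    have h1 : α * m ^ 2 ≤ α * K ^ 2 := by gcongr
    have h2 : α * m * m ≤ 1 / 2 * m := by linarith
    have h3 := le_of_mul_le_mul_right h2 hm0
    linarith
  have hρρ : 1 - α * m / 2 < 1 - 1 / (4000 * D / 2) := by
    have : 1 / (4000 * D / 2) < 1 / (764 * D) :=
      one_div_lt_one_div_of_lt (by positivity) (by linarith)
    linarith
  have hlρ : GTGDA.lam W ≤ 1 - 1 / (4000 * D / 2) := by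
    have h1 : 1 / (4000 * D / 2) ≤ 1 / κ :=
      one_div_le_one_div_of_le (by linarith) (by linarith)
    have h2 : 1 / κ = μ / L' := by rw [hκ, one_div_div]
    rw [← hl]
    linarith
  obtain ⟨hsaddle, hunique⟩ := A.existsUnique_saddle hprob
  refine ⟨xs, Y xs, hsaddle, hunique, fun x₀ y₀ => ?_⟩
  rw [hm, hK] at hαK
  rw [hm, hK, hl] at hV
  rw [hm] at hρ0 hρρ
  obtain ⟨ψ, hψ, hconv⟩ := A.exists_error_le hα0.le hαK hβ0.le hβL hw ha hb hz hζ hT hρ0 hρρ hlρ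
    hV x₀ y₀
  refine ⟨⟨ψ, hψ, fun k => (hconv k).trans ?_⟩, GTGDA.complexity_of_linear hψ (by linarith) hconv⟩
  have h1 : 1 / (4000 * D) ≤ 1 / (4000 * D / 2) :=
    one_div_le_one_div_of_le (by positivity) (by linarith)
  have h2 : 0 ≤ 1 - 1 / (4000 * D / 2) := (GTGDA.lam_nonneg W).trans hlρ
  gcongr
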